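/- Let $R$ be a finite chain ring, i.e. a nonzero finite associative ring with $1$, possibly noncommutative, whose left ideals form a chain under inclusion. Let $\mathfrak m = R\theta$ be its maximal left ideal, let $m \ge 1$ be the smallest positive integer with $\theta^m = 0$, and let $q = |R/\mathfrak m|$. Let $w\colon R \to \mathbb Z_{\ge 0}$ be a weight with $w(0)=0$ and $w(r)>0$ for $r \neq 0$, having maximal symmetry: $w(ur)=w(ru)=w(r)$ for all $r\in R$ and all units $u$ of $R$. Put $w_j = w(\theta^j)$, and suppose that $w$ is weakly monotone: $w_0 \le w_1 \le \cdots \le w_{m-1}$. Extend $w$ to $R^n$ by $w(x)=\sum_{i=1}^n w(x_i)$, let $w_{\max}$ be the largest value of $w$ on $R$, and for $C \subseteq R^n$ put $$\mathrm{wwe}_C(X,Y)=\sum_{x\in C} X^{\,n w_{\max}-w(x)}\,Y^{\,w(x)}.$$ For a left $R$-linear code $C\subseteq R^n$ (a left $R$-submodule) let $\mathcal R(C)=\{y\in R^n : \sum_{i=1}^n x_i y_i=0 \text{ for all } x\in C\}$. The weight $w$ respects duality if, for all $n\ge 1$ and all left $R$-linear codes $C,D\subseteq R^n$, $\mathrm{wwe}_C=\mathrm{wwe}_D$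 implies $\mathrm{wwe}_{\mathcal R(C)}=\mathrm{wwe}_{\mathcal R(D)}$. Then $w$ does not respect duality, except in the following cases, in each of which it does respect duality: - $w$ is a positive integer multiple of the Hamming weight (the weight equal to $0$ at $0$ and to $1$ at every nonzero element), or - $m=2$, $q=2$ and $w_1=2w_0$. -/

import Mathlib

namespace RingWeight

/-- A ring is a chain ring if its left ideals form a chain under inclusion
(`Ideal R` is the type of left ideals of `R`). Used only for finite nontrivial rings. -/
def IsChainRing (R : Type*) [Ring R] : Prop :=
  ∀ I J : Ideal R, I ≤ J ∨ J ≤ I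

/-- A weight with positive integer values, except for `w 0 = 0`. -/
def IsPositiveWeight {R : Type*} [Ring R] (w : R → ℕ) : Prop :=
  w 0 = 0 ∧ ∀ r : R, r ≠ 0 → 0 < w r

/-- Maximal symmetry: both the left and the right symmetry group of `w`
are the full group of units. -/
def HasMaximalSymmetry {R : Type*} [Ring R] (w : R → ℕ) : Prop :=
  (∀ (u : Rˣ) (r : R), w (↑u * r) = w r) ∧ (∀ (u : Rˣ) (r : R), w (r * ↑u) = w r)

/-- The additive extension of a weight to `R ^ n`. -/
def vecWeight {R : Type*} (w : R → ℕ) {n : ℕ} (x : Fin n → R) : ℕ :=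
  ∑ i, w (x i)

/-- The largest value of a weight on a finite ring. -/
noncomputable def maxWeight {R : Type*} (w : R → ℕ) : ℕ :=
  ⨆ r, w r

/-- The `w`-weight enumerator `∑ x ∈ C, X ^ (n * w_max - w x) * Y ^ (w x)` of `C ⊆ R ^ n`,
as a polynomial in the two variables `X = X 0` and `Y = X 1`. -/
noncomputable def wwe {R : Type*} (w : R → ℕ) {n : ℕ} (C : Set (Fin n → R)) :
    MvPolynomial (Fin 2) ℤ :=
  ∑ᶠ x ∈ C, MvPolynomial.X 0 ^ (n * maxWeight w - vecWeight w x) *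
    MvPolynomial.X 1 ^ vecWeight w x

/-- The right dual code `{y | x · y = 0 for all x ∈ C}` of a left linear code `C ⊆ R ^ n`;
it is a right submodule of `R ^ n`. -/
def rightDual {R : Type*} [Ring R] {n : ℕ} (C : Submodule R (Fin n → R)) :
    Submodule Rᵐᵒᵖ (Fin n → R) where
  carrier := {y | ∀ x ∈ C, ∑ i, x i * y i = 0}
  zero_mem' := by
    intro x _
    simp
  add_mem' := by
    intro a b ha hb x hx
    simp only [Pi.add_apply, mul_add, Finset.sum_add_distrib]
    rw [ha x hx, hb x hx, add_zero]
  smul_mem' := by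
    intro c a ha x hx
    have h := ha x hx
    simp only [Pi.smul_apply, MulOpposite.smul_eq_mul_unop, ← mul_assoc, ← Finset.sum_mul]
    rw [h, zero_mul]

/-- `w` respects duality: left linear codes of the same length with equal `w`-weight enumerators
have right dual codes with equal `w`-weight enumerators. -/
def RespectsDuality {R : Type*} [Ring R] (w : R → ℕ) : Prop :=
  ∀ n : ℕ, 1 ≤ n → ∀ C D : Submodule R (Fin n → R),
    wwe w (C : Set (Fin n → R)) = wwe w (D : Set (Fin n → R)) →
    wwe w (rightDual C : Set (Fin n → R)) = wwe w (rightDual D : Set (Fin n → R))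

open Classical in
/-- The Hamming weight on `R`. -/
noncomputable def hammingWeight {R : Type*} [Ring R] (r : R) : ℕ :=
  if r = 0 then 0 else 1

/-- `w` is a positive integer multiple of the Hamming weight. -/
def IsMultipleOfHamming {R : Type*} [Ring R] (w : R → ℕ) : Prop :=
  ∃ c : ℕ, 0 < c ∧ ∀ r : R, w r = c * hammingWeight r

/-- `w_0 ≤ w_1 ≤ ⋯ ≤ w_{m-1}`, where `w_j = w (θ ^ j)` is the common value of `w` on the unit
multiples of `θ ^ j`. -/
def IsWeaklyMonotone {R : Type*} [Ring R] (w : R → ℕ) (θ : R) (m : ℕ) : Prop :=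
  ∀ i j : ℕ, i ≤ j → j < m → w (θ ^ i) ≤ w (θ ^ j)

end RingWeight

namespace RingWeight

/-! Every nonzero element is a unit times some `θ ^ l` with `l < m`, and `θ ^ (m - 1)` lies in every
nonzero one-sided ideal. Hence an additive character nontrivial at `θ ^ (m - 1)` is generating on
both sides.

Sufficiency is MacWilliams duality. If the Fourier transform of `b ↦ X ^ w b` at `x` has the form `U
^ e x * V ^ (E - e x)` with `w` proportional to `e`, Poisson summation makes the enumerator of the
dual a function of that of the code (`respectsDuality_of_fourier`). Both exceptional weights have
such a transform.

Necessity compares, for each `1 ≤ j ≤ m`, two codes of size `q ^ j`, one from the cyclic module `Rθ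
^ (m - j)` and one from the `j`-th power of the socle `Rθ ^ (m - 1)`. Suitable column multiplicities
give every nonzero codeword of both the same weight, so the enumerators agree. Dual words of weight
below `2 * w_0` have one nonzero entry and can be counted column by column. For a set `P` of weights
below `2 * w_0` that contains `w_0`, write `N_l` for the number of `b` with `P (w b)` and `θ ^ l * b
≠ 0`. The comparison yields `∑ x, w (x * θ ^ l) = N_l * w_{m-1}` (`sum_weight_eq_card_mul`).

Let `K` be the first index with `w_K ≠ w_0`, if there is one. Taking `P = {w_0}` gives `q ^ K * w_0
= (q ^ K - 1) * w_{m-1}`. If `w_{m-1} < 2 * w_0`, taking for `P` all positive weights below `2 *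
w_0` gives a contradiction; otherwise `q ^ K ≤ 2`, which leaves only the second exception. -/

/-- `θ` generates the left ideal of nonunits and has nilpotency index `m`. -/
structure IsUniformizer {R : Type*} [Ring R] (θ : R) (m : ℕ) : Prop where
  not_isUnit_iff : ∀ x : R, ¬ IsUnit x ↔ ∃ y, x = y * θ
  pow_eq_zero_iff : ∀ i : ℕ, θ ^ i = 0 ↔ m ≤ i

/-! ### Arithmetic of finite chain rings -/

section ChainRing

variable {R : Type*} [Ring R]

theorem isUniformizer_of_isChainRing [Finite R] [Nontrivial R] (hR : IsChainRing R) {θ : R}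
    (hθ : (Ideal.span {θ} : Ideal R).IsMaximal) {m : ℕ}
    (hm : IsLeast {k : ℕ | 1 ≤ k ∧ θ ^ k = 0} m) : IsUniformizer θ m := by
  refine ⟨fun x => ⟨fun hx => ?_, ?_⟩, fun i => ⟨fun hi => ?_, fun hi => ?_⟩⟩
  · by_contra hcon
    have hxθ : x ∉ (Ideal.span {θ} : Ideal R) := by
      intro h
      obtain ⟨y, hy⟩ := Ideal.mem_span_singleton'.1 h
      exact hcon ⟨y, hy.symm⟩
    have hle : (Ideal.span {θ} : Ideal R) ≤ Ideal.span {x} := by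
      rcases hR (Ideal.span {θ}) (Ideal.span {x}) with h | h
      · exact h
      · exact absurd (h (Ideal.mem_span_singleton_self x)) hxθ
    have htop : (Ideal.span {x} : Ideal R) = ⊤ := by
      by_contra hne
      exact hxθ ((hθ.eq_of_le hne hle) ▸ Ideal.mem_span_singleton_self x)
    obtain ⟨y, hy⟩ := Ideal.mem_span_singleton'.1 (htop ▸ Submodule.mem_top : (1 : R) ∈ Ideal.span {x})
    exact hx (IsUnit.of_mul_eq_one_right y hy)
  · rintro ⟨y, rfl⟩ hu
    exact hθ.ne_top (Ideal.eq_top_of_isUnit_mem _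
      (Ideal.mem_span_singleton'.2 ⟨y, rfl⟩) hu)
  · rcases Nat.eq_zero_or_pos i with rfl | h
    · simp at hi
    · exact hm.2 ⟨h, hi⟩
  · exact pow_eq_zero_of_le hi hm.1.2

theorem card_span_mul_card_quotient [Finite R] (θ : R) :
    Nat.card (Ideal.span {θ} : Ideal R) * Nat.card (R ⧸ (Ideal.span {θ} : Ideal R)) =
      Nat.card R :=
  AddSubgroup.card_mul_index (Ideal.span {θ} : Ideal R).toAddSubgroup

namespace IsUniformizer

variable {θ : R} {m : ℕ} (h : IsUniformizer θ m)
include h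

theorem pos [Nontrivial R] : 0 < m := by
  by_contra hm
  have := (h.pow_eq_zero_iff 0).2 (by omega)
  simp at this

theorem exists_eq_unit_mul_pow {x : R} (hx : x ≠ 0) : ∃ u : Rˣ, ∃ l < m, x = u * θ ^ l := by
  classical
  have hex : ∃ l, ¬ ∃ y, x = y * θ ^ l := by
    refine ⟨m, ?_⟩
    rintro ⟨y, hy⟩
    rw [(h.pow_eq_zero_iff m).2 le_rfl, mul_zero] at hy
    exact hx hy
  have hpos : Nat.find hex ≠ 0 := by
    intro h0
    have := Nat.find_spec hex
    rw [h0] at this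
    exact this ⟨x, by simp⟩
  obtain ⟨l, hl⟩ := Nat.exists_eq_succ_of_ne_zero hpos
  have hl1 := Nat.find_min hex (m := l) (by omega)
  have hl2 := Nat.find_spec hex
  rw [hl] at hl2
  push Not at hl1
  obtain ⟨y, hy⟩ := hl1
  have hu : IsUnit y := by
    by_contra hu
    obtain ⟨z, hz⟩ := (h.not_isUnit_iff y).1 hu
    exact hl2 ⟨z, by rw [hy, hz, pow_succ', mul_assoc]⟩
  obtain ⟨u, rfl⟩ := hu
  refine ⟨u, l, ?_, hy⟩
  by_contra hlm
  rw [(h.pow_eq_zero_iff l).2 (by omega), mul_zero] at hy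
  exact hx hy

theorem exists_pow_mul_eq [Finite R] (l : ℕ) (r : R) : ∃ s, θ ^ l * r = s * θ ^ l := by
  have h1 : ∀ r : R, ∃ s, θ * r = s * θ := by
    intro r
    rw [← h.not_isUnit_iff]
    intro hu
    obtain ⟨u, hu⟩ := hu
    have : θ * (r * ↑u⁻¹) = 1 := by rw [← mul_assoc, ← hu]; simp
    exact (h.not_isUnit_iff θ).2 ⟨1, by simp⟩ (IsUnit.of_mul_eq_one _ this)
  induction l generalizing r with
  | zero => exact ⟨r, by simp⟩
  | succ l ih =>
    obtain ⟨s, hs⟩ := h1 r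
    obtain ⟨t, ht⟩ := ih s
    exact ⟨t, by rw [pow_succ, mul_assoc, hs, ← mul_assoc, ht, mul_assoc]⟩

/-- A Nakayama argument: if the factor moved to the left were a nonunit, `θ ^ l` would be a left
multiple of `θ ^ (l + 1)`, hence killed by a unit of the form `1 - z * t * θ`. -/
theorem exists_pow_mul_unit_eq [Finite R] (l : ℕ) (v : Rˣ) :
    ∃ u : Rˣ, θ ^ l * v = u * θ ^ l := by
  by_cases hl : θ ^ l = 0
  · exact ⟨1, by simp [hl]⟩
  obtain ⟨y, hy⟩ := h.exists_pow_mul_eq l v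
  have hu : IsUnit y := by
    by_contra hu
    obtain ⟨z, rfl⟩ := (h.not_isUnit_iff y).1 hu
    obtain ⟨t, ht⟩ := h.exists_pow_mul_eq (l + 1) (↑v⁻¹ : R)
    have h1 : θ ^ l = z * t * θ * θ ^ l := by
      calc θ ^ l = θ ^ l * v * (↑v⁻¹ : R) := by rw [mul_assoc]; simp
        _ = z * (θ ^ (l + 1) * (↑v⁻¹ : R)) := by rw [hy, pow_succ']; simp only [mul_assoc]
        _ = z * t * θ * θ ^ l := by rw [ht, pow_succ']; simp only [mul_assoc]
    have hunit : IsUnit (1 - z * t * θ) := by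
      by_contra hn
      obtain ⟨a, ha⟩ := (h.not_isUnit_iff _).1 hn
      exact (h.not_isUnit_iff 1).2 ⟨a + z * t, by rw [add_mul, ← ha]; abel⟩ isUnit_one
    apply hl
    have h2 : (1 - z * t * θ) * θ ^ l = 0 := by rw [sub_mul, one_mul, ← h1, sub_self]
    exact (hunit.mul_right_eq_zero).1 h2
  obtain ⟨u, rfl⟩ := hu
  exact ⟨u, hy⟩

theorem pow_mul_unit_mul_pow_eq_zero_iff [Finite R] (l s : ℕ) (u : Rˣ) :
    θ ^ l * (u * θ ^ s) = 0 ↔ m ≤ l + s := by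
  obtain ⟨v, hv⟩ := h.exists_pow_mul_unit_eq l u
  rw [← mul_assoc, hv, mul_assoc, ← pow_add, Units.mul_right_eq_zero, h.pow_eq_zero_iff]

theorem mem_span_pow_iff [Finite R] {u : Rˣ} {s i : ℕ} (hs : s < m) :
    (u : R) * θ ^ s ∈ (Ideal.span {θ ^ i} : Ideal R) ↔ i ≤ s := by
  rw [Ideal.mem_span_singleton']
  constructor
  · rintro ⟨y, hy⟩
    by_contra hlt
    have h1 : y * θ ^ i * θ ^ (m - i) = 0 := by
      rw [mul_assoc, ← pow_add, (h.pow_eq_zero_iff _).2 (by omega), mul_zero]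
    rw [hy, mul_assoc, ← pow_add, Units.mul_right_eq_zero, h.pow_eq_zero_iff] at h1
    omega
  · intro hi
    exact ⟨u * θ ^ (s - i), by rw [mul_assoc, ← pow_add, Nat.sub_add_cancel hi]⟩

theorem pow_mul_eq_zero_iff [Finite R] {l : ℕ} (hl : l ≤ m) (b : R) :
    θ ^ l * b = 0 ↔ b ∈ (Ideal.span {θ ^ (m - l)} : Ideal R) := by
  by_cases hb : b = 0
  · simp [hb]
  obtain ⟨u, s, hs, rfl⟩ := h.exists_eq_unit_mul_pow hb
  rw [h.mem_span_pow_iff hs, h.pow_mul_unit_mul_pow_eq_zero_iff]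
  omega

theorem mul_pow_eq_zero_iff [Finite R] {l : ℕ} (hl : l ≤ m) (b : R) :
    b * θ ^ l = 0 ↔ b ∈ (Ideal.span {θ ^ (m - l)} : Ideal R) := by
  by_cases hb : b = 0
  · simp [hb]
  obtain ⟨u, s, hs, rfl⟩ := h.exists_eq_unit_mul_pow hb
  rw [h.mem_span_pow_iff hs, mul_assoc, ← pow_add, Units.mul_right_eq_zero, h.pow_eq_zero_iff]
  omega

theorem mem_span_iff (x : R) : x ∈ (Ideal.span {θ} : Ideal R) ↔ ¬ IsUnit x := by
  rw [h.not_isUnit_iff, Ideal.mem_span_singleton']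
  simp only [eq_comm]

/-- Right multiplication by `θ ^ l` has image `Rθ ^ l` and kernel `Rθ ^ (m - l)`. -/
theorem card_span_pow_mul_card_span_pow [Finite R] {l : ℕ} (hl : l ≤ m) :
    Nat.card (Ideal.span {θ ^ l} : Ideal R) * Nat.card (Ideal.span {θ ^ (m - l)} : Ideal R) =
      Nat.card R := by
  have hr : ((AddMonoidHom.mulRight (θ ^ l)).range : Set R) =
      ((Ideal.span {θ ^ l} : Ideal R) : Set R) := by
    ext x; simp [Ideal.mem_span_singleton']
  have hk : ((AddMonoidHom.mulRight (θ ^ l)).ker : Set R) =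
      ((Ideal.span {θ ^ (m - l)} : Ideal R) : Set R) := by
    ext x
    simpa [AddMonoidHom.mem_ker] using h.mul_pow_eq_zero_iff hl x
  have h1 := AddSubgroup.card_mul_index (AddMonoidHom.mulRight (θ ^ l)).ker
  rw [AddSubgroup.index_ker, mul_comm] at h1
  rw [← h1]
  congr 1
  · exact (congrArg (fun s : Set R => Nat.card s) hr).symm
  · exact (congrArg (fun s : Set R => Nat.card s) hk).symm

/-- Right multiplication by `θ` maps `Rθ ^ l` onto `Rθ ^ (l + 1)` with kernel `Rθ ^ (m - 1)`, which
has as many elements as the residue ring. -/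
theorem card_span_pow_succ_mul [Finite R] {l : ℕ} (hl : l < m) :
    Nat.card (Ideal.span {θ ^ (l + 1)} : Ideal R) * Nat.card (R ⧸ (Ideal.span {θ} : Ideal R)) =
      Nat.card (Ideal.span {θ ^ l} : Ideal R) := by
  have h1 := h.card_span_pow_mul_card_span_pow (show 1 ≤ m by omega)
  rw [pow_one] at h1
  have h2 := card_span_mul_card_quotient θ
  have hq : Nat.card (Ideal.span {θ ^ (m - 1)} : Ideal R) =
      Nat.card (R ⧸ (Ideal.span {θ} : Ideal R)) :=
    Nat.eq_of_mul_eq_mul_left Nat.card_pos (h1.trans h2.symm)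
  let f : (Ideal.span {θ ^ l} : Ideal R).toAddSubgroup →+ R :=
    (AddMonoidHom.mulRight θ).comp (AddSubgroup.subtype _)
  have hr : (f.range : Set R) = ((Ideal.span {θ ^ (l + 1)} : Ideal R) : Set R) := by
    ext x
    simp only [f, AddMonoidHom.coe_range, Set.mem_range, SetLike.mem_coe,
      Ideal.mem_span_singleton']
    constructor
    · rintro ⟨⟨y, hy⟩, rfl⟩
      obtain ⟨a, rfl⟩ := Ideal.mem_span_singleton'.1 hy
      exact ⟨a, by simp [pow_succ, mul_assoc]⟩
    · rintro ⟨a, rfl⟩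
      exact ⟨⟨a * θ ^ l, Ideal.mem_span_singleton'.2 ⟨a, rfl⟩⟩, by simp [pow_succ, mul_assoc]⟩
  have hk : Nat.card f.ker = Nat.card (Ideal.span {θ ^ (m - 1)} : Ideal R) := by
    have hmem : ∀ y : R, y * θ = 0 ↔ y ∈ (Ideal.span {θ ^ (m - 1)} : Ideal R) := by
      intro y
      simpa using h.mul_pow_eq_zero_iff (show 1 ≤ m by omega) y
    refine Nat.card_congr ⟨fun y => ⟨y.1.1, (hmem _).1 y.2⟩,
      fun y => ⟨⟨y.1, ?_⟩, (hmem _).2 y.2⟩, fun _ => rfl, fun _ => rfl⟩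
    obtain ⟨a, ha⟩ := Ideal.mem_span_singleton'.1 y.2
    refine Ideal.mem_span_singleton'.2 ⟨a * θ ^ (m - 1 - l), ?_⟩
    rw [← ha, mul_assoc, ← pow_add, Nat.sub_add_cancel (by omega)]
  have h3 := AddSubgroup.card_mul_index f.ker
  rw [AddSubgroup.index_ker, hk, hq, mul_comm] at h3
  have hr' := congrArg (fun s : Set R => Nat.card s) hr
  exact (congrArg (· * _) hr'.symm).trans h3

theorem card_span_pow [Finite R] {l : ℕ} (hl : l ≤ m) :
    Nat.card (Ideal.span {θ ^ (m - l)} : Ideal R) =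
      Nat.card (R ⧸ (Ideal.span {θ} : Ideal R)) ^ l := by
  induction l with
  | zero => simp [(h.pow_eq_zero_iff m).2 le_rfl]
  | succ l ih =>
    have h1 := h.card_span_pow_succ_mul (show m - (l + 1) < m by omega)
    rw [show m - (l + 1) + 1 = m - l by omega, ih (by omega)] at h1
    rw [← h1, pow_succ]

theorem card_eq [Finite R] :
    Nat.card R = Nat.card (R ⧸ (Ideal.span {θ} : Ideal R)) ^ m := by
  rw [← h.card_span_pow le_rfl]
  simp

/-- The left and right ideals generated by `θ ^ (m - 1)` coincide. -/
theorem exists_pow_mul_eq_mul_pow [Finite R] [Nontrivial R] (a : R) :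
    ∃ b, θ ^ (m - 1) * b = a * θ ^ (m - 1) := by
  have hm := h.pos
  let f := AddMonoidHom.mulLeft (θ ^ (m - 1))
  let g := AddMonoidHom.mulRight (θ ^ (m - 1))
  -- Both kernels are `Rθ`, so the two images have the same size and the inclusion of one in the
  -- other is an equality.
  have hker : f.ker = g.ker := by
    ext x
    simp only [f, g, AddMonoidHom.mem_ker, AddMonoidHom.coe_mulLeft, AddMonoidHom.mulRight_apply]
    rw [h.pow_mul_eq_zero_iff (by omega), h.mul_pow_eq_zero_iff (by omega)]
  have hle : f.range ≤ g.range := by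
    rintro _ ⟨b, rfl⟩
    obtain ⟨s, hs⟩ := h.exists_pow_mul_eq (m - 1) b
    exact ⟨s, hs.symm⟩
  have hcard : Nat.card g.range ≤ Nat.card f.range := by
    rw [← AddSubgroup.index_ker, ← AddSubgroup.index_ker, hker]
  have heq : f.range = g.range := AddSubgroup.eq_of_le_of_card_ge hle hcard
  have : a * θ ^ (m - 1) ∈ f.range := heq ▸ ⟨a, rfl⟩
  exact this

/-- Every nonzero right ideal contains `θ ^ (m - 1)`. -/
theorem exists_mul_eq_pow [Finite R] [Nontrivial R] {x : R} (hx : x ≠ 0) :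
    ∃ b, x * b = θ ^ (m - 1) := by
  obtain ⟨u, l, hl, rfl⟩ := h.exists_eq_unit_mul_pow hx
  obtain ⟨b, hb⟩ := h.exists_pow_mul_eq_mul_pow (↑u⁻¹ : R)
  refine ⟨θ ^ (m - 1 - l) * b, ?_⟩
  calc ↑u * θ ^ l * (θ ^ (m - 1 - l) * b) = u * (θ ^ (l + (m - 1 - l)) * b) := by
        rw [pow_add]; simp only [mul_assoc]
    _ = θ ^ (m - 1) := by
        rw [Nat.add_sub_cancel' (by omega), hb, Units.mul_inv_cancel_left]

/-- Every nonzero left ideal contains `θ ^ (m - 1)`. -/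
theorem exists_mul_eq_pow' {x : R} (hx : x ≠ 0) : ∃ b, b * x = θ ^ (m - 1) := by
  obtain ⟨u, l, hl, rfl⟩ := h.exists_eq_unit_mul_pow hx
  refine ⟨θ ^ (m - 1 - l) * ↑u⁻¹, ?_⟩
  rw [mul_assoc, Units.inv_mul_cancel_left, ← pow_add, Nat.sub_add_cancel (by omega)]

end IsUniformizer

end ChainRing

/-! ### Information carried by the weight enumerator -/

section Enumerator

variable {R : Type*} [Finite R] (w : R → ℕ) {n : ℕ}

/-- The sum is the image of the enumerator under the linear map that reads off the exponent of `Y`;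
the exponent of `X` carries no further information. -/
theorem finsum_mem_eq_of_wwe_eq {S T : Set (Fin n → R)} (hST : wwe w S = wwe w T)
    {A : Type*} [AddCommGroup A] (g : ℕ → A) :
    ∑ᶠ x ∈ S, g (vecWeight w x) = ∑ᶠ x ∈ T, g (vecWeight w x) := by
  let φ : MvPolynomial (Fin 2) ℤ →ₗ[ℤ] A :=
    (MvPolynomial.basisMonomials (Fin 2) ℤ).constr ℤ fun s => g (s 1)
  have hφ : ∀ a b : ℕ, φ (MvPolynomial.X 0 ^ a * MvPolynomial.X 1 ^ b) = g b := by
    intro a b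
    have : (MvPolynomial.X 0 ^ a * MvPolynomial.X 1 ^ b : MvPolynomial (Fin 2) ℤ) =
        MvPolynomial.basisMonomials (Fin 2) ℤ (Finsupp.single 0 a + Finsupp.single 1 b) := by
      simp [MvPolynomial.X_pow_eq_monomial, MvPolynomial.monomial_mul]
    rw [this, Module.Basis.constr_basis]
    simp
  have key : ∀ S : Set (Fin n → R), ∑ᶠ x ∈ S, g (vecWeight w x) = φ (wwe w S) := by
    intro S
    have := (φ.toAddMonoidHom).map_finsum_mem (fun x : Fin n → R =>
      MvPolynomial.X 0 ^ (n * maxWeight w - vecWeight w x) * MvPolynomial.X 1 ^ vecWeight w x)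
      (Set.toFinite S)
    refine Eq.trans ?_ this.symm
    simp [hφ]
  rw [key, key, hST]

theorem wwe_eq_of_finsum_mem_eq {S T : Set (Fin n → R)}
    (hST : ∑ᶠ x ∈ S, (Polynomial.X : Polynomial ℤ) ^ vecWeight w x =
      ∑ᶠ x ∈ T, (Polynomial.X : Polynomial ℤ) ^ vecWeight w x) : wwe w S = wwe w T := by
  let φ : Polynomial ℤ →ₗ[ℤ] MvPolynomial (Fin 2) ℤ :=
    (Polynomial.basisMonomials ℤ).constr ℤ fun k =>
      MvPolynomial.X 0 ^ (n * maxWeight w - k) * MvPolynomial.X 1 ^ k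
  have hφ : ∀ k : ℕ, φ (Polynomial.X ^ k) =
      MvPolynomial.X 0 ^ (n * maxWeight w - k) * MvPolynomial.X 1 ^ k := by
    intro k
    have : (Polynomial.X ^ k : Polynomial ℤ) = Polynomial.basisMonomials ℤ k := by
      simp [Polynomial.X_pow_eq_monomial]
    rw [this, Module.Basis.constr_basis]
  have key : ∀ S : Set (Fin n → R),
      wwe w S = φ (∑ᶠ x ∈ S, (Polynomial.X : Polynomial ℤ) ^ vecWeight w x) := by
    intro S
    have := (φ.toAddMonoidHom).map_finsum_mem (fun x : Fin n → R =>
      (Polynomial.X : Polynomial ℤ) ^ vecWeight w x) (Set.toFinite S)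
    refine Eq.trans ?_ this.symm
    simp [hφ, wwe]
  rw [key, key, hST]

omit [Finite R] in
theorem wwe_eq_of_equiv {S T : Set (Fin n → R)} (e : S ≃ T)
    (he : ∀ x, vecWeight w (e x : Fin n → R) = vecWeight w (x : Fin n → R)) :
    wwe w S = wwe w T := by
  rw [wwe, wwe, ← finsum_set_coe_eq_finsum_mem S, ← finsum_set_coe_eq_finsum_mem T]
  exact finsum_eq_of_bijective e e.bijective fun x => by rw [he]

theorem card_eq_of_wwe_eq {S T : Set (Fin n → R)} (hST : wwe w S = wwe w T) (P : ℕ → Prop) :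
    Nat.card {x // x ∈ S ∧ P (vecWeight w x)} = Nat.card {x // x ∈ T ∧ P (vecWeight w x)} := by
  classical
  have h := finsum_mem_eq_of_wwe_eq w hST (fun k => if P k then (1 : ℤ) else 0)
  have key : ∀ S : Set (Fin n → R), ∑ᶠ x ∈ S, (if P (vecWeight w x) then (1 : ℤ) else 0) =
      Nat.card {x // x ∈ S ∧ P (vecWeight w x)} := by
    intro S
    have := Fintype.ofFinite R
    rw [finsum_mem_eq_toFinset_sum, Finset.sum_boole, Nat.card_eq_fintype_card,
      Fintype.card_subtype]
    congr 2
    ext x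
    simp
  rw [key, key] at h
  exact_mod_cast h

end Enumerator

/-- The consequence of respecting duality for codes indexed by an arbitrary finite type. -/
theorem RespectsDuality.card_dual_eq {R : Type*} [Ring R] [Finite R] {w : R → ℕ}
    (hw : RespectsDuality w) {ι : Type*} [Fintype ι] [Nonempty ι] (C D : Submodule R (ι → R))
    (e : C ≃ D) (he : ∀ x : C, ∑ i, w ((e x : ι → R) i) = ∑ i, w ((x : ι → R) i))
    (P : ℕ → Prop) :
    Nat.card {y : ι → R // (∀ x ∈ C, ∑ i, x i * y i = 0) ∧ P (∑ i, w (y i))} =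
      Nat.card {y : ι → R // (∀ x ∈ D, ∑ i, x i * y i = 0) ∧ P (∑ i, w (y i))} := by
  let σ := Fintype.equivFin ι
  let L : (ι → R) ≃ₗ[R] (Fin (Fintype.card ι) → R) := LinearEquiv.funCongrLeft R R σ.symm
  have hL : ∀ x i, L x (σ i) = x i := by
    intro x i
    simp [L, LinearEquiv.funCongrLeft_apply, LinearMap.funLeft_apply]
  have hLw : ∀ x, vecWeight w (L x) = ∑ i, w (x i) := by
    intro x
    rw [vecWeight, ← σ.sum_comp]
    simp only [hL]
  have hdual : ∀ C : Submodule R (ι → R),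
      Nat.card {y : ι → R // (∀ x ∈ C, ∑ i, x i * y i = 0) ∧ P (∑ i, w (y i))} =
      Nat.card {y // y ∈ (rightDual (C.map L.toLinearMap) : Set (Fin (Fintype.card ι) → R)) ∧
        P (vecWeight w y)} := by
    intro C
    refine Nat.card_congr (L.toEquiv.subtypeEquiv fun y => ?_)
    have h1 : (∀ x ∈ C, ∑ i, x i * y i = 0) ↔
        L y ∈ (rightDual (C.map L.toLinearMap) : Set (Fin (Fintype.card ι) → R)) := by
      change _ ↔ ∀ x ∈ C.map L.toLinearMap, ∑ i, x i * L y i = 0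
      simp only [Submodule.mem_map, LinearEquiv.coe_coe, forall_exists_index, and_imp,
        forall_apply_eq_imp_iff₂]
      refine forall₂_congr fun x _ => ?_
      rw [← σ.sum_comp]
      simp only [hL]
    rw [h1]
    exact and_congr Iff.rfl (by rw [← hLw y]; rfl)
  rw [hdual, hdual]
  refine card_eq_of_wwe_eq w (hw _ Fintype.card_pos _ _ ?_) P
  refine wwe_eq_of_equiv w
    (((L.submoduleMap C).symm.toEquiv.trans e).trans (L.submoduleMap D).toEquiv) ?_
  intro x
  obtain ⟨x, rfl⟩ := (L.submoduleMap C).surjective x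
  simp only [Equiv.trans_apply, LinearEquiv.coe_toEquiv, LinearEquiv.symm_apply_apply,
    LinearEquiv.submoduleMap_apply, hLw, he]

/-! ### Sufficiency: Fourier transform and MacWilliams duality -/

section MacWilliams

open Polynomial

variable {R : Type*} [Ring R] [Fintype R] [Nontrivial R] {θ : R} {m : ℕ}
  {A : Type*} [CommRing A] [IsDomain A]

theorem IsUniformizer.sum_char_mul_eq_zero (h : IsUniformizer θ m) (χ : AddChar R A)
    (hχ : χ (θ ^ (m - 1)) ≠ 1) {x : R} (hx : x ≠ 0) : ∑ b, χ (x * b) = 0 := by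
  obtain ⟨b, hb⟩ := h.exists_mul_eq_pow hx
  refine AddChar.sum_eq_zero_of_ne_one (ψ := χ.compAddMonoidHom (AddMonoidHom.mulLeft x)) ?_
  exact AddChar.ne_one_iff.2 ⟨b, by simpa [hb] using hχ⟩

omit [Nontrivial R] in
open scoped Classical in
/-- The Poisson summation formula for a left linear code and its right dual code. -/
theorem IsUniformizer.sum_prod_fourier (h : IsUniformizer θ m) (χ : AddChar R A)
    (hχ : χ (θ ^ (m - 1)) ≠ 1) (f : R → A) {n : ℕ} (C : Submodule R (Fin n → R)) :
    ∑ x : C, ∏ i, ∑ b, χ ((x : Fin n → R) i * b) * f b =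
      Nat.card C * ∑ y with y ∈ rightDual C, ∏ i, f (y i) := by
  have hchar : ∀ y : Fin n → R, ∑ x : C, χ (∑ i, (x : Fin n → R) i * y i) =
      if y ∈ rightDual C then (Nat.card C : A) else 0 := by
    intro y
    let g : C →+ R :=
      { toFun := fun x => ∑ i, (x : Fin n → R) i * y i
        map_zero' := by simp
        map_add' := fun a b => by simp [add_mul, Finset.sum_add_distrib] }
    split_ifs with hy
    · have : ∀ x : C, χ (∑ i, (x : Fin n → R) i * y i) = 1 := by
        intro x
        rw [show ∑ i, (x : Fin n → R) i * y i = 0 from hy x x.2, AddChar.map_zero_eq_one]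
      simp [this]
    · have hy' : ∃ x ∈ C, ∑ i, x i * y i ≠ 0 := by
        by_contra hcon
        push Not at hcon
        exact hy hcon
      obtain ⟨x, hx, hne⟩ := hy'
      -- A left multiple of `x` stays in the code and can be chosen to pair with `y` to `θ ^ (m -
      -- 1)`, where `χ` is nontrivial.
      obtain ⟨b, hb⟩ := h.exists_mul_eq_pow' hne
      refine AddChar.sum_eq_zero_of_ne_one (ψ := χ.compAddMonoidHom g) ?_
      refine AddChar.ne_one_iff.2 ⟨⟨b • x, C.smul_mem b hx⟩, ?_⟩
      have : g ⟨b • x, C.smul_mem b hx⟩ = θ ^ (m - 1) := by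
        rw [← hb, Finset.mul_sum]
        simp [g, mul_assoc]
      simpa [this] using hχ
  calc ∑ x : C, ∏ i, ∑ b, χ ((x : Fin n → R) i * b) * f b
      = ∑ x : C, ∑ y : Fin n → R, χ (∑ i, (x : Fin n → R) i * y i) * ∏ i, f (y i) := by
        refine Finset.sum_congr rfl fun x _ => ?_
        rw [Finset.prod_univ_sum]
        simp only [Fintype.piFinset_univ, Finset.prod_mul_distrib]
        refine Finset.sum_congr rfl fun y _ => ?_
        rw [show χ (∑ i, (x : Fin n → R) i * y i) = ∏ i, χ ((x : Fin n → R) i * y i) from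
          map_prod χ.toMonoidHom (fun i => Multiplicative.ofAdd ((x : Fin n → R) i * y i)) _]
    _ = ∑ y : Fin n → R, (if y ∈ rightDual C then (Nat.card C : A) else 0) * ∏ i, f (y i) := by
        rw [Finset.sum_comm]
        simp only [← Finset.sum_mul, hchar]
    _ = Nat.card C * ∑ y with y ∈ rightDual C, ∏ i, f (y i) := by
        rw [Finset.mul_sum, Finset.sum_filter]
        refine Finset.sum_congr rfl fun y _ => ?_
        split_ifs <;> simp

omit [Nontrivial R] in
/-- A weight respects duality if the Fourier transform of `b ↦ X ^ w b` at `x` depends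
multiplicatively on the weight of `x`. -/
theorem IsUniformizer.respectsDuality_of_fourier (h : IsUniformizer θ m) {w : R → ℕ}
    (χ : AddChar R ℂ[X]) (hχ : χ (θ ^ (m - 1)) ≠ 1) (a : ℕ) (ha : 0 < a) (e : R → ℕ)
    (he : ∀ x, w x = a * e x) (E : ℕ) (hE : ∀ x, e x ≤ E) (U V : ℂ[X])
    (hf : ∀ x, ∑ b, χ (x * b) * X ^ w b = U ^ e x * V ^ (E - e x)) : RespectsDuality w := by
  classical
  intro n _ C D hCD
  have hcard : Nat.card C = Nat.card D := by
    have h1 := card_eq_of_wwe_eq w hCD (fun _ => True)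
    simpa using h1
  have hprod : ∀ x : Fin n → R, ∏ i, ∑ b, χ (x i * b) * X ^ w b =
      (fun k : ℕ => U ^ (k / a) * V ^ (n * E - k / a)) (vecWeight w x) := by
    intro x
    -- Dividing by `a` recovers the total of `e`, so the product of the transforms depends on the
    -- weight of `x` alone.
    have h1 : vecWeight w x / a = ∑ i, e (x i) := by
      rw [vecWeight]
      simp only [he]
      rw [← Finset.mul_sum, Nat.mul_div_cancel_left _ ha]
    have h2 : ∑ i, (E - e (x i)) = n * E - ∑ i, e (x i) := by
      rw [Finset.sum_tsub_distrib _ fun i _ => hE (x i)]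
      simp
    simp only [hf, h1]
    rw [Finset.prod_mul_distrib, Finset.prod_pow_eq_pow_sum, Finset.prod_pow_eq_pow_sum, h2]
  have hsum : ∀ C : Submodule R (Fin n → R),
      ∑ x : C, ∏ i, ∑ b, χ ((x : Fin n → R) i * b) * X ^ w b =
      ∑ᶠ x ∈ (C : Set (Fin n → R)),
        (fun k : ℕ => U ^ (k / a) * V ^ (n * E - k / a)) (vecWeight w x) := by
    intro C
    rw [← finsum_set_coe_eq_finsum_mem (C : Set (Fin n → R)), finsum_eq_sum_of_fintype]
    exact Finset.sum_congr rfl fun x _ => hprod x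
  have hdual : ∀ C : Submodule R (Fin n → R),
      ∑ y with y ∈ rightDual C, ∏ i, (X : ℂ[X]) ^ w (y i) =
      (∑ᶠ y ∈ (rightDual C : Set (Fin n → R)), (X : ℤ[X]) ^ vecWeight w y).map
        (Int.castRingHom ℂ) := by
    intro C
    have h1 := (Polynomial.mapRingHom (Int.castRingHom ℂ)).toAddMonoidHom.map_finsum_mem
      (fun y : Fin n → R => (X : ℤ[X]) ^ vecWeight w y)
      (Set.toFinite (rightDual C : Set (Fin n → R)))
    refine Eq.trans ?_ h1.symm
    rw [finsum_mem_eq_toFinset_sum]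
    refine Finset.sum_congr ?_ fun y _ => ?_
    · ext; simp
    · simp [Finset.prod_pow_eq_pow_sum, vecWeight]
  apply wwe_eq_of_finsum_mem_eq
  apply Polynomial.map_injective (Int.castRingHom ℂ) Int.cast_injective
  rw [← hdual, ← hdual]
  have hC := h.sum_prod_fourier χ hχ (fun b => (X : ℂ[X]) ^ w b) C
  have hD := h.sum_prod_fourier χ hχ (fun b => (X : ℂ[X]) ^ w b) D
  rw [hsum, finsum_mem_eq_of_wwe_eq w hCD (fun k : ℕ => U ^ (k / a) * V ^ (n * E - k / a)),
    ← hsum, hD, hcard] at hC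
  exact (mul_left_cancel₀ (Nat.cast_ne_zero.2 Nat.card_pos.ne') hC).symm

theorem IsUniformizer.exists_char (h : IsUniformizer θ m) :
    ∃ χ : AddChar R ℂ[X], χ (θ ^ (m - 1)) ≠ 1 := by
  have hm := h.pos
  have hne : θ ^ (m - 1) ≠ 0 := fun h0 => by
    have := (h.pow_eq_zero_iff _).1 h0
    omega
  obtain ⟨ψ, hψ⟩ := AddChar.exists_apply_ne_zero.2 hne
  refine ⟨(Polynomial.C : ℂ →+* ℂ[X]).toMonoidHom.compAddChar ψ, ?_⟩
  simpa using fun h1 => hψ (Polynomial.C_injective (h1.trans Polynomial.C_1.symm))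

theorem IsUniformizer.respectsDuality_of_isMultipleOfHamming (h : IsUniformizer θ m) {w : R → ℕ}
    (hw : IsMultipleOfHamming w) : RespectsDuality w := by
  classical
  obtain ⟨c, hc, hw⟩ := hw
  obtain ⟨χ, hχ⟩ := h.exists_char
  refine h.respectsDuality_of_fourier χ hχ c hc hammingWeight hw 1
    (fun x => by unfold hammingWeight; split_ifs <;> simp) (1 - X ^ c)
    (1 + ((Fintype.card R : ℂ[X]) - 1) * X ^ c) fun x => ?_
  have hX : ∀ b : R, (X : ℂ[X]) ^ w b = X ^ c + (1 - X ^ c) * if b = 0 then 1 else 0 := by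
    intro b
    rw [hw, hammingWeight]
    split_ifs <;> simp
  simp only [hX, mul_add, Finset.sum_add_distrib, ← Finset.sum_mul]
  by_cases hx : x = 0
  · subst hx
    simp [hammingWeight]
    ring
  · rw [h.sum_char_mul_eq_zero χ hχ hx]
    simp [hammingWeight, hx]

/-- The ring has four elements, with nonunits `0` and `θ`, and `w` is a multiple of the analogue of
the Lee weight on `ℤ/4`. With `a = w 1`, the transform is `(1 + X ^ a) ^ 2` at `0`, `(1 - X ^ a) *
(1 + X ^ a)` at units and `(1 - X ^ a) ^ 2` at `θ`. -/
theorem IsUniformizer.respectsDuality_of_lee (h : IsUniformizer θ 2)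
    (hq : Nat.card (R ⧸ (Ideal.span {θ} : Ideal R)) = 2) {w : R → ℕ} (hw : IsPositiveWeight w)
    (hsymm : HasMaximalSymmetry w) (h1 : w (θ ^ 1) = 2 * w (θ ^ 0)) : RespectsDuality w := by
  classical
  obtain ⟨χ, hχ⟩ := h.exists_char
  rw [pow_one, pow_zero] at h1
  rw [show 2 - 1 = 1 from rfl, pow_one] at hχ
  have hθ2 : θ * θ = 0 := by
    rw [← pow_two]; exact (h.pow_eq_zero_iff 2).2 le_rfl
  have hθ0 : θ ≠ 0 := fun h0 => by
    have := (h.pow_eq_zero_iff 1).1 (by simpa using h0)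
    omega
  have hcard : Nat.card (Ideal.span {θ} : Ideal R) = 2 := by
    have := h.card_span_pow (l := 1) (by norm_num)
    rwa [hq, show 2 - 1 = 1 from rfl, pow_one, pow_one] at this
  have hspan : ∀ x : R, ¬ IsUnit x → x = 0 ∨ x = θ := by
    intro x hx
    by_contra hcon
    push Not at hcon
    have hx' := (h.mem_span_iff x).2 hx
    have h3 : ({0, θ, x} : Finset R).card ≤ Nat.card (Ideal.span {θ} : Ideal R) := by
      rw [← Set.ncard_coe_finset]
      refine (Set.ncard_le_ncard (t := ((Ideal.span {θ} : Ideal R) : Set R)) ?_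
        (Set.toFinite _))
      intro y hy
      simp only [Finset.coe_insert, Finset.coe_singleton, Set.mem_insert_iff,
        Set.mem_singleton_iff] at hy
      rcases hy with rfl | rfl | rfl
      · exact Submodule.zero_mem _
      · exact Ideal.mem_span_singleton_self _
      · exact hx'
    rw [Finset.card_eq_three.2 ⟨0, θ, x, hθ0.symm, hcon.1.symm, hcon.2.symm, rfl⟩, hcard] at h3
    omega
  have hunit : ∀ u : Rˣ, w u = w 1 := fun u => by simpa using hsymm.1 u 1
  have hnθ : ¬ IsUnit θ := (h.not_isUnit_iff θ).2 ⟨1, by simp⟩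
  have hn0 : ¬ IsUnit (0 : R) := not_isUnit_zero
  have huθ : ∀ u : Rˣ, (u : R) * θ = θ := by
    intro u
    refine (hspan _ ((h.not_isUnit_iff _).2 ⟨u, rfl⟩)).resolve_left ?_
    rw [Units.mul_right_eq_zero]
    exact hθ0
  have hχθ : χ θ = -1 := by
    have h2 : θ + θ = 0 := by
      refine (hspan _ ((h.not_isUnit_iff _).2 ⟨2, by rw [two_mul]⟩)).resolve_right ?_
      simpa using hθ0
    have h3 : χ θ * χ θ = 1 := by rw [← AddChar.map_add_eq_mul, h2, AddChar.map_zero_eq_one]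
    exact (mul_self_eq_one_iff.1 h3).resolve_left hχ
  have hpos : 0 < w 1 := hw.2 1 one_ne_zero
  set a := w 1 with ha
  let e : R → ℕ := fun x => if IsUnit x then 1 else if x = 0 then 0 else 2
  have he : ∀ x, w x = a * e x := by
    intro x
    by_cases hx : IsUnit x
    · obtain ⟨u, rfl⟩ := hx
      simp [e, hunit]
    · rcases hspan x hx with rfl | rfl
      · simp [e, hw.1]
      · simp [e, hx, hθ0, h1, mul_comm]
  refine h.respectsDuality_of_fourier χ (by simpa using hχ) a hpos e he 2
    (fun x => by simp only [e]; split_ifs <;> norm_num) (1 - X ^ a) (1 + X ^ a) fun x => ?_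
  have hX : ∀ b : R, (X : ℂ[X]) ^ w b = X ^ a + (1 - X ^ a) * (if b = 0 then 1 else 0) +
      (X ^ (2 * a) - X ^ a) * (if b = θ then 1 else 0) := by
    intro b
    by_cases hb : IsUnit b
    · have h0 : b ≠ 0 := fun h0 => hn0 (h0 ▸ hb)
      have h2 : b ≠ θ := fun h0 => hnθ (h0 ▸ hb)
      obtain ⟨u, rfl⟩ := hb
      simp [hunit, h0, h2]
    · rcases hspan b hb with rfl | rfl
      · simp [hw.1, hθ0.symm]
      · simp [hθ0, h1]
  have hsum : ∑ b, χ (x * b) * X ^ w b = (∑ b, χ (x * b)) * X ^ a + (1 - X ^ a) +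
      (X ^ (2 * a) - X ^ a) * χ (x * θ) := by
    simp only [hX, mul_add, Finset.sum_add_distrib, ← Finset.sum_mul]
    simp [mul_comm]
  rw [hsum]
  by_cases hx0 : x = 0
  · subst hx0
    have hR : Fintype.card R = 4 := by
      rw [← Nat.card_eq_fintype_card, h.card_eq, hq]
      norm_num
    simp [e, hR]
    ring
  rw [h.sum_char_mul_eq_zero χ (by simpa using hχ) hx0]
  by_cases hx : IsUnit x
  · obtain ⟨u, rfl⟩ := hx
    simp [e, huθ, hχθ]
    ring
  · obtain rfl := (hspan x hx).resolve_left hx0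
    simp [e, hθ2, hθ0, hnθ]
    ring

end MacWilliams

/-! ### Constant weight codes and light dual codewords -/

/-- Multiplicities that turn a monotone sequence of weights into a constant one. -/
theorem exists_multiplicity {v : ℕ → ℕ} {m : ℕ} (hzero : ∀ s, m ≤ s → v s = 0)
    (hmono : ∀ i j, i ≤ j → j < m → v i ≤ v j) (hpos : 0 < v (m - 1)) {j : ℕ} (hj : 1 ≤ j)
    (hjm : j ≤ m) :
    ∃ η : ℕ → ℕ, 0 < η 0 ∧ ∀ s, m - j ≤ s → s < m →
      ∑ i ∈ Finset.range j, η i * v (s + i) = η 0 * v (m - 1) := by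
  induction j, hj using Nat.le_induction with
  | base =>
    refine ⟨fun _ => 1, one_pos, fun s hs hsm => ?_⟩
    obtain rfl : s = m - 1 := by omega
    simp
  | succ j hj ih =>
    obtain ⟨η, h0, hη⟩ := ih (by omega)
    -- The deficit at the new index `m - (j + 1)`, nonnegative by monotonicity. Used as the
    -- multiplicity of the new column, it has no effect at larger `s`, where `v (s + j) = 0`;
    -- scaling the old multiplicities by `v (m - 1)` keeps everything integral.
    let d := ∑ i ∈ Finset.range j, η i * v (m - j + i) -
      ∑ i ∈ Finset.range j, η i * v (m - (j + 1) + i)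
    have hle : ∑ i ∈ Finset.range j, η i * v (m - (j + 1) + i) ≤
        ∑ i ∈ Finset.range j, η i * v (m - j + i) := by
      refine Finset.sum_le_sum fun i hi => Nat.mul_le_mul_left _ ?_
      rw [Finset.mem_range] at hi
      exact hmono _ _ (by omega) (by omega)
    refine ⟨fun i => if i < j then v (m - 1) * η i else d, ?_, fun s hs hsm => ?_⟩
    · simp only [show 0 < j by omega, if_true]
      positivity
    · have hsum : ∑ i ∈ Finset.range j, (if i < j then v (m - 1) * η i else d) * v (s + i) =
          v (m - 1) * ∑ i ∈ Finset.range j, η i * v (s + i) := by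
        rw [Finset.mul_sum]
        refine Finset.sum_congr rfl fun i hi => ?_
        rw [if_pos (Finset.mem_range.1 hi), mul_assoc]
      rw [Finset.sum_range_succ, hsum]
      simp only [lt_irrefl, if_false, show 0 < j by omega, if_true]
      by_cases hsj : m - j ≤ s
      · rw [hη s hsj hsm, hzero (s + j) (by omega)]
        ring
      · obtain rfl : s = m - (j + 1) := by omega
        rw [show m - (j + 1) + j = m - 1 by omega, mul_comm d, ← mul_add,
          Nat.add_sub_cancel' hle, hη _ le_rfl (by omega)]
        ring

theorem card_add_card_not {α : Type*} [Finite α] (p : α → Prop) :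
    Nat.card {a // p a} + Nat.card {a // ¬ p a} = Nat.card α := by
  classical
  rw [← Nat.card_sum]
  exact Nat.card_congr (Equiv.sumCompl p)

section DualCount

variable {R : Type*} [Ring R] [Finite R] {w : R → ℕ}

/-- Dual codewords whose weight is below twice the minimum weight have a single nonzero entry. -/
theorem card_dual_eq_sum {v₀ : ℕ} (hw0 : w 0 = 0) (hmin : ∀ b, b ≠ 0 → v₀ ≤ w b) {P : ℕ → Prop}
    (hP : ∀ k, P k → 0 < k ∧ k < 2 * v₀) {M : Type*} [AddCommGroup M] [Module R M]
    {ι : Type*} [Fintype ι] (f : ι → M →ₗ[R] R) :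
    Nat.card {y : ι → R // (∀ x ∈ LinearMap.range (LinearMap.pi f), ∑ i, x i * y i = 0) ∧
        P (∑ i, w (y i))} =
      ∑ i, Nat.card {b // P (w b) ∧ ∀ x, f i x * b = 0} := by
  classical
  rw [← Nat.card_sigma]
  have hsum : ∀ (i : ι) (b : R), ∑ k, w ((Pi.single i b : ι → R) k) = w b := by
    intro i b
    rw [Finset.sum_eq_single i]
    · simp
    · intro k _ hk
      simp [hk, hw0]
    · simp
  have hdual : ∀ y : ι → R, (∀ x ∈ LinearMap.range (LinearMap.pi f), ∑ i, x i * y i = 0) ↔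
      ∀ x, ∑ i, f i x * y i = 0 := by
    intro y
    simp
  have hdual' : ∀ i b x, ∑ k, f k x * (Pi.single i b : ι → R) k = f i x * b := by
    intro i b x
    rw [Finset.sum_eq_single i]
    · simp
    · intro k _ hk
      simp [hk]
    · simp
  let F : (Σ i, {b // P (w b) ∧ ∀ x, f i x * b = 0}) →
      {y : ι → R // (∀ x ∈ LinearMap.range (LinearMap.pi f), ∑ i, x i * y i = 0) ∧
        P (∑ i, w (y i))} := fun p =>
    ⟨Pi.single p.1 p.2.1, (hdual _).2 fun x => by rw [hdual']; exact p.2.2.2 x,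
      by rw [hsum]; exact p.2.2.1⟩
  symm
  refine Nat.card_congr (Equiv.ofBijective F ⟨?_, ?_⟩)
  · rintro ⟨i, b, hb, hb'⟩ ⟨k, c, hc, hc'⟩ heq
    have heq' : (Pi.single i b : ι → R) = Pi.single k c := congrArg Subtype.val heq
    have hb0 : b ≠ 0 := by
      rintro rfl
      rw [hw0] at hb
      exact (hP _ hb).1.ne rfl
    have hik : i = k := by
      by_contra hne
      have := congrFun heq' i
      simp [hne] at this
      exact hb0 this
    subst hik
    have : b = c := by simpa using congrFun heq' i
    subst this
    rfl
  · rintro ⟨y, hy, hyP⟩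
    have hex : ∃ i, y i ≠ 0 := by
      by_contra hcon
      push Not at hcon
      have := (hP _ hyP).1
      simp [hcon, hw0] at this
    obtain ⟨i, hi⟩ := hex
    have hone : ∀ k, k ≠ i → y k = 0 := by
      intro k hk
      by_contra hne
      have h1 : w (y k) + w (y i) ≤ ∑ i, w (y i) := by
        rw [← Finset.sum_pair (f := fun i => w (y i)) hk]
        exact Finset.sum_le_univ_sum_of_nonneg fun _ => Nat.zero_le _
      have h2 := (hP _ hyP).2
      have h3 := hmin _ hne
      have h4 := hmin _ hi
      omega
    have hys : y = Pi.single i (y i) := by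
      ext k
      by_cases hk : k = i
      · subst hk; simp
      · simp [hk, hone k hk]
    rw [hys, hsum] at hyP
    rw [hdual, hys] at hy
    simp only [hdual'] at hy
    exact ⟨⟨i, y i, hyP, hy⟩, Subtype.ext hys.symm⟩

omit [Finite R] in
theorem pi_injective_of_constant_weight (hw0 : w 0 = 0) {M : Type*} [AddCommGroup M]
    [Module R M] {ι : Type*} [Fintype ι] (f : ι → M →ₗ[R] R) {W : ℕ} (hW : 0 < W)
    (hf : ∀ x, x ≠ 0 → ∑ i, w (f i x) = W) : Function.Injective (LinearMap.pi f) := by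
  rw [injective_iff_map_eq_zero]
  intro x hx
  by_contra hne
  have h1 := hf x hne
  have h2 : ∀ i, f i x = 0 := fun i => congrFun hx i
  simp only [h2, hw0, Finset.sum_const_zero] at h1
  omega

omit [Finite R] in
/-- Two constant weight codes of the same size are related by a weight preserving bijection. -/
theorem exists_equiv_of_constant_weight (hw0 : w 0 = 0) {M N : Type*} [AddCommGroup M]
    [Module R M] [Finite M] [AddCommGroup N] [Module R N] [Finite N]
    (hMN : Nat.card M = Nat.card N) {ι : Type*} [Fintype ι] (f : ι → M →ₗ[R] R)
    (g : ι → N →ₗ[R] R) {W : ℕ} (hW : 0 < W) (hf : ∀ x, x ≠ 0 → ∑ i, w (f i x) = W)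
    (hg : ∀ x, x ≠ 0 → ∑ i, w (g i x) = W) :
    ∃ e : LinearMap.range (LinearMap.pi f) ≃ LinearMap.range (LinearMap.pi g),
      ∀ x, ∑ i, w ((e x : ι → R) i) = ∑ i, w ((x : ι → R) i) := by
  classical
  let e₁ := LinearEquiv.ofInjective _ (pi_injective_of_constant_weight hw0 f hW hf)
  let e₂ := LinearEquiv.ofInjective _ (pi_injective_of_constant_weight hw0 g hW hg)
  -- An arbitrary bijection adjusted to fix `0`, the only element of a different weight.
  let e₀ : M ≃ N := (Finite.card_eq.1 hMN).some.setValue 0 0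
  have he₀ : e₀ 0 = 0 := Equiv.setValue_eq _ _ _
  refine ⟨(e₁.symm.toEquiv.trans e₀).trans e₂.toEquiv, fun x => ?_⟩
  obtain ⟨x, rfl⟩ := e₁.surjective x
  simp only [Equiv.trans_apply, LinearEquiv.coe_toEquiv, LinearEquiv.symm_apply_apply]
  change ∑ i, w (g i (e₀ x)) = ∑ i, w (f i x)
  by_cases hx : x = 0
  · subst hx
    rw [he₀]
    simp
  · rw [hf x hx, hg]
    rw [← he₀]
    exact fun hc => hx (e₀.injective hc)

/-- A numerical condition on two families of columns that define codes of constant weight. -/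
theorem RespectsDuality.sum_card_eq (hw : RespectsDuality w) {v₀ : ℕ} (hw0 : w 0 = 0)
    (hmin : ∀ b, b ≠ 0 → v₀ ≤ w b) {P : ℕ → Prop} (hP : ∀ k, P k → 0 < k ∧ k < 2 * v₀)
    {M N : Type*} [AddCommGroup M] [Module R M] [Finite M] [AddCommGroup N] [Module R N]
    [Finite N] (hMN : Nat.card M = Nat.card N) {κ κ' : Type*} [Fintype κ] [Fintype κ']
    [Nonempty κ] (f : κ → M →ₗ[R] R) (g : κ' → N →ₗ[R] R) {W : ℕ} (hW : 0 < W)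
    (hf : ∀ x, x ≠ 0 → ∑ i, w (f i x) = W) (hg : ∀ x, x ≠ 0 → ∑ i, w (g i x) = W) :
    ∑ i, Nat.card {b // P (w b) ∧ ∃ x, f i x * b ≠ 0} =
      ∑ i, Nat.card {b // P (w b) ∧ ∃ x, g i x * b ≠ 0} := by
  -- Zero columns bring both codes to the same length. Each zero column admits every `b` with `P (w
  -- b)`, so passing to the complementary counts cancels the padding.
  let f' : κ ⊕ κ' → M →ₗ[R] R := Sum.elim f 0
  let g' : κ ⊕ κ' → N →ₗ[R] R := Sum.elim 0 g
  obtain ⟨e, he⟩ := exists_equiv_of_constant_weight hw0 hMN f' g' hW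
    (fun x hx => by simp [f', hw0, hf x hx]) (fun x hx => by simp [g', hw0, hg x hx])
  have h1 := hw.card_dual_eq _ _ e he P
  rw [card_dual_eq_sum hw0 hmin hP, card_dual_eq_sum hw0 hmin hP] at h1
  have hT : ∀ Q : R → Prop, Nat.card {b // P (w b)} =
      Nat.card {b // P (w b) ∧ Q b} + Nat.card {b // P (w b) ∧ ¬ Q b} := by
    intro Q
    classical
    have := Fintype.ofFinite R
    simp only [Nat.card_eq_fintype_card, Fintype.card_subtype]
    rw [← Finset.filter_filter, ← Finset.filter_filter, Finset.card_filter_add_card_filter_not]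
  have hf' := fun i => hT fun b => ∀ x, f i x * b = 0
  have hg' := fun i => hT fun b => ∀ x, g i x * b = 0
  simp only [not_forall] at hf' hg'
  simp only [Fintype.sum_sum_type, f', g', Sum.elim_inl, Sum.elim_inr, Pi.zero_apply,
    LinearMap.zero_apply, zero_mul, implies_true, and_true] at h1
  have hf'' := Finset.sum_congr (rfl : (Finset.univ : Finset κ) = _) fun i _ => hf' i
  have hg'' := Finset.sum_congr (rfl : (Finset.univ : Finset κ') = _) fun i _ => hg' i
  rw [Finset.sum_add_distrib] at hf'' hg''
  simp only [ne_eq]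
  omega

end DualCount

/-! ### Necessity: comparing the cyclic code with the socle code -/

section NecessaryCondition

variable {R : Type*} [Ring R] [Fintype R] [Nontrivial R] {θ : R} {m : ℕ}

omit [Nontrivial R] in
theorem IsUniformizer.card_notMem_span_pow (h : IsUniformizer θ m) {q : ℕ}
    (hq : q = Nat.card (R ⧸ (Ideal.span {θ} : Ideal R))) {i : ℕ} (hi : i ≤ m) :
    Nat.card {b // b ∉ (Ideal.span {θ ^ i} : Ideal R)} + q ^ (m - i) = q ^ m := by
  classical
  have h1 := h.card_span_pow (show m - i ≤ m by omega)
  rw [show m - (m - i) = i by omega, ← hq] at h1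
  rw [hq, ← h.card_eq, ← hq, ← h1]
  have h2 : Nat.card (Ideal.span {θ ^ i} : Ideal R) =
      Nat.card {b // b ∈ (Ideal.span {θ ^ i} : Ideal R)} := rfl
  rw [h2, add_comm]
  exact card_add_card_not _

omit [Nontrivial R] in
theorem IsUniformizer.two_le_card_quotient (h : IsUniformizer θ m) {q : ℕ}
    (hq : q = Nat.card (R ⧸ (Ideal.span {θ} : Ideal R))) : 2 ≤ q := by
  have hne : (Ideal.span {θ} : Ideal R) ≠ ⊤ := by
    rw [Ideal.ne_top_iff_one, h.mem_span_iff]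
    simp
  have : Nontrivial (R ⧸ (Ideal.span {θ} : Ideal R)) := Submodule.Quotient.nontrivial_iff.2 hne
  have : Finite (R ⧸ (Ideal.span {θ} : Ideal R)) :=
    Finite.of_surjective _ (Submodule.mkQ_surjective (Ideal.span {θ} : Ideal R))
  rw [hq]
  exact Finite.one_lt_card

variable {w : R → ℕ}

omit [Fintype R] [Nontrivial R] in
theorem HasMaximalSymmetry.weight_unit_mul (hs : HasMaximalSymmetry w) (u : Rˣ) (s : ℕ) :
    w (u * θ ^ s) = w (θ ^ s) := hs.1 u _

omit [Fintype R] [Nontrivial R] in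
theorem IsUniformizer.weight_one_le (h : IsUniformizer θ m) (hs : HasMaximalSymmetry w)
    (hmono : IsWeaklyMonotone w θ m) {b : R} (hb : b ≠ 0) : w (θ ^ 0) ≤ w b := by
  obtain ⟨u, l, hl, rfl⟩ := h.exists_eq_unit_mul_pow hb
  rw [hs.weight_unit_mul]
  exact hmono 0 l (Nat.zero_le _) hl

omit [Fintype R] [Nontrivial R] in
theorem IsUniformizer.weight_le_last (h : IsUniformizer θ m) (hs : HasMaximalSymmetry w)
    (hmono : IsWeaklyMonotone w θ m) {b : R} (hb : b ≠ 0) : w b ≤ w (θ ^ (m - 1)) := by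
  obtain ⟨u, l, hl, rfl⟩ := h.exists_eq_unit_mul_pow hb
  rw [hs.weight_unit_mul]
  exact hmono l (m - 1) (by omega) (by omega)

omit [Nontrivial R] in
/-- The sum of the weights in the column multiset `x ↦ x * θ ^ i` with multiplicities `η i`. -/
theorem IsUniformizer.sum_multiplicity_mul_sum_weight (h : IsUniformizer θ m) {q : ℕ}
    (hq : q = Nat.card (R ⧸ (Ideal.span {θ} : Ideal R))) (hs : HasMaximalSymmetry w)
    (hw0 : w 0 = 0) {j : ℕ} (hjm : j ≤ m) {η : ℕ → ℕ} {W : ℕ}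
    (hη : ∀ s, m - j ≤ s → s < m → ∑ i ∈ Finset.range j, η i * w (θ ^ (s + i)) = W) :
    ∑ i ∈ Finset.range j, η i * ∑ x, w (x * θ ^ (m - j + i)) + q ^ (m - j) * W = q ^ m * W := by
  classical
  have hx : ∀ x : R, ∑ i ∈ Finset.range j, η i * w (x * θ ^ (m - j + i)) =
      if x ∈ (Ideal.span {θ ^ j} : Ideal R) then 0 else W := by
    intro x
    split_ifs with hx
    · have h0 := (h.mul_pow_eq_zero_iff (show m - j ≤ m by omega) x).2
        (by rwa [show m - (m - j) = j by omega])
      refine Finset.sum_eq_zero fun i _ => ?_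
      rw [pow_add, ← mul_assoc, h0, zero_mul, hw0, mul_zero]
    · have hne : x ≠ 0 := by rintro rfl; exact hx (Submodule.zero_mem _)
      obtain ⟨u, s, hsm, rfl⟩ := h.exists_eq_unit_mul_pow hne
      rw [h.mem_span_pow_iff hsm, not_le] at hx
      rw [← hη (s + (m - j)) (by omega) (by omega)]
      refine Finset.sum_congr rfl fun i _ => ?_
      rw [mul_assoc, ← pow_add, hs.weight_unit_mul, add_assoc]
  have hsum : ∑ i ∈ Finset.range j, η i * ∑ x, w (x * θ ^ (m - j + i)) =
      Nat.card {b // b ∉ (Ideal.span {θ ^ j} : Ideal R)} * W := by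
    simp only [Finset.mul_sum]
    rw [Finset.sum_comm]
    simp only [hx]
    rw [Finset.sum_ite, Finset.sum_const_zero, zero_add, Finset.sum_const, smul_eq_mul,
      Nat.card_eq_fintype_card, Fintype.card_subtype]
  rw [hsum, ← add_mul, h.card_notMem_span_pow hq hjm]

theorem card_sigma_fin_sum {j : ℕ} (c : ℕ → ℕ) (F : ℕ → ℕ) :
    ∑ p : Σ i : Fin j, Fin (c i), F p.1 = ∑ i ∈ Finset.range j, c i * F i := by
  rw [Fintype.sum_sigma, ← Fin.sum_univ_eq_sum_range (fun i => c i * F i)]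
  simp

omit [Fintype R] [Nontrivial R] in
/-- The linear form `x ↦ ∑ k, x k * a k` restricted to vectors over a left ideal. -/
theorem exists_linear_form (I : Ideal R) {j : ℕ} (a : Fin j → R) :
    ∃ f : (Fin j → I) →ₗ[R] R, ∀ x, f x = ∑ k, (x k : R) * a k :=
  ⟨∑ k, (LinearMap.toSpanSingleton R R (a k)).comp (I.subtype.comp (LinearMap.proj k)),
    fun x => by simp [LinearMap.sum_apply]⟩

omit [Fintype R] [Nontrivial R] in
theorem IsUniformizer.mul_mem_span_pow [Finite R] (h : IsUniformizer θ m) {l : ℕ} {a : R}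
    (ha : a ∈ (Ideal.span {θ ^ l} : Ideal R)) (b : R) :
    a * b ∈ (Ideal.span {θ ^ l} : Ideal R) := by
  obtain ⟨c, rfl⟩ := Ideal.mem_span_singleton'.1 ha
  obtain ⟨d, hd⟩ := h.exists_pow_mul_eq l b
  rw [mul_assoc, hd, ← mul_assoc]
  exact Ideal.mem_span_singleton'.2 ⟨_, rfl⟩

/-- For fixed nonzero `x`, the additive map `a ↦ ∑ k, x k * a k` is onto the socle, which has `q`
elements, so its kernel has index `q`. -/
theorem IsUniformizer.card_sum_mul_ne_zero (h : IsUniformizer θ m) {q : ℕ}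
    (hq : q = Nat.card (R ⧸ (Ideal.span {θ} : Ideal R))) {j : ℕ} (hj : 1 ≤ j)
    (x : Fin j → (Ideal.span {θ ^ (m - 1)} : Ideal R)) (hx : x ≠ 0) :
    Nat.card {a : Fin j → R // ∑ k, (x k : R) * a k ≠ 0} = (q - 1) * q ^ (m * j - 1) := by
  classical
  have hm := h.pos
  let g : (Fin j → R) →+ R :=
    { toFun := fun a => ∑ k, (x k : R) * a k
      map_zero' := by simp
      map_add' := fun a b => by simp [mul_add, Finset.sum_add_distrib] }
  have hrange : (g.range : Set R) = ((Ideal.span {θ ^ (m - 1)} : Ideal R) : Set R) := by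
    ext z
    constructor
    · rintro ⟨a, rfl⟩
      change ∑ k, (x k : R) * a k ∈ (Ideal.span {θ ^ (m - 1)} : Ideal R)
      exact Ideal.sum_mem (Ideal.span {θ ^ (m - 1)}) fun k _ => h.mul_mem_span_pow (x k).2 (a k)
    · intro hz
      obtain ⟨c, rfl⟩ := Ideal.mem_span_singleton'.1 hz
      obtain ⟨k, hk⟩ := Function.ne_iff.1 hx
      have hk' : (x k : R) ≠ 0 := fun h0 => hk (Subtype.ext h0)
      obtain ⟨b, hb⟩ := h.exists_mul_eq_pow hk'
      obtain ⟨d, hd⟩ := h.exists_pow_mul_eq_mul_pow c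
      refine ⟨Pi.single k (b * d), ?_⟩
      change ∑ i, (x i : R) * (Pi.single k (b * d) : Fin j → R) i = _
      rw [Finset.sum_eq_single k]
      · rw [Pi.single_eq_same, ← mul_assoc, hb, hd]
      · intro i _ hi
        simp [hi]
      · simp
  have hcr : Nat.card g.range = q := by
    have h1 := h.card_span_pow (l := 1) (by omega)
    rw [pow_one, ← hq] at h1
    rw [← h1]
    exact congrArg (fun s : Set R => Nat.card s) hrange
  have h2 := AddSubgroup.card_mul_index g.ker
  rw [AddSubgroup.index_ker, hcr, Nat.card_fun, h.card_eq, ← hq, Nat.card_fin, ← pow_mul] at h2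
  have hmj : 1 ≤ m * j := Nat.mul_pos hm hj
  have hq2 := h.two_le_card_quotient hq
  have hker : Nat.card g.ker = q ^ (m * j - 1) := by
    apply Nat.eq_of_mul_eq_mul_right (show 0 < q by omega)
    rw [h2, ← pow_succ, Nat.sub_add_cancel hmj]
  have h3 : Nat.card {a : Fin j → R // ∑ k, (x k : R) * a k = 0} +
      Nat.card {a : Fin j → R // ¬ ∑ k, (x k : R) * a k = 0} = q ^ (m * j) := by
    rw [card_add_card_not, Nat.card_fun,
      h.card_eq, ← hq, Nat.card_fin, ← pow_mul]
  have h4 : Nat.card {a : Fin j → R // ∑ k, (x k : R) * a k = 0} = q ^ (m * j - 1) := by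
    rw [← hker]
    rfl
  rw [h4] at h3
  have h5 : q ^ (m * j) = q * q ^ (m * j - 1) := by
    rw [← pow_succ', Nat.sub_add_cancel hmj]
  rw [h5] at h3
  have h6 := Nat.sub_mul q 1 (q ^ (m * j - 1))
  simp only [ne_eq]
  omega

omit [Nontrivial R] in
theorem IsUniformizer.card_exists_isUnit (h : IsUniformizer θ m) (hm : 1 ≤ m) {q : ℕ}
    (hq : q = Nat.card (R ⧸ (Ideal.span {θ} : Ideal R))) (j : ℕ) :
    Nat.card {a : Fin j → R // ∃ k, IsUnit (a k)} + q ^ ((m - 1) * j) = q ^ (m * j) := by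
  classical
  have h1 := h.card_span_pow (l := m - 1) (by omega)
  rw [show m - (m - 1) = 1 by omega, pow_one, ← hq] at h1
  have h2 : Nat.card {a : Fin j → R // ¬ ∃ k, IsUnit (a k)} = q ^ ((m - 1) * j) := by
    rw [pow_mul, ← h1]
    conv_rhs => rw [← Nat.card_fin j]
    rw [← Nat.card_fun]
    exact Nat.card_congr
      ⟨fun a k => ⟨a.1 k, (h.mem_span_iff _).2 fun hk => a.2 ⟨k, hk⟩⟩,
        fun a => ⟨fun k => a k, fun ⟨k, hk⟩ => (h.mem_span_iff _).1 (a k).2 hk⟩,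
        fun _ => rfl, fun _ => rfl⟩
  rw [← h2, card_add_card_not, Nat.card_fun,
    h.card_eq, ← hq, Nat.card_fin, ← pow_mul]

/-- Here `B * A` equals `(q - 1) * q ^ (m * j - 1)` times `q ^ m - q ^ (m - j)`, and the common
factor cancels. -/
theorem add_mul_pow_eq_of_mul_eq {q m j T A B e : ℕ} (hq : 2 ≤ q) (hj : 1 ≤ j) (hjm : j ≤ m)
    (hA : A + q ^ (m - 1) = q ^ m) (hB : B + q ^ ((m - 1) * j) = q ^ (m * j))
    (hT : (q - 1) * q ^ (m * j - 1) * T = e * (B * A)) : T + e * q ^ (m - j) = e * q ^ m := by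
  obtain ⟨c, rfl⟩ : ∃ c, m = c + j := ⟨m - j, by omega⟩
  obtain ⟨d, rfl⟩ : ∃ d, j = d + 1 := ⟨j - 1, by omega⟩
  obtain ⟨r, rfl⟩ : ∃ r, q = r + 1 := ⟨q - 1, by omega⟩
  have e1 : c + (d + 1) - 1 = c + d := by omega
  have e2 : (c + (d + 1)) * (d + 1) - 1 = (c + d) * (d + 1) + d := by
    rw [show (c + (d + 1)) * (d + 1) = (c + d) * (d + 1) + d + 1 by ring]; rfl
  have e3 : c + (d + 1) - (d + 1) = c := by omega
  rw [e1] at hA hB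
  rw [e2, Nat.add_sub_cancel] at hT
  rw [e3]
  have hpos : 0 < r * (r + 1) ^ ((c + d) * (d + 1) + d) :=
    Nat.mul_pos (by omega) (by positivity)
  apply Nat.eq_of_mul_eq_mul_left hpos
  zify at *
  have hA' : (A : ℤ) = (r + 1) ^ (c + d) * r := by
    linear_combination hA
  have hB' : (B : ℤ) = (r + 1) ^ ((c + d) * (d + 1)) * ((r + 1) ^ (d + 1) - 1) := by
    linear_combination hB
  rw [hA', hB'] at hT
  rw [mul_add, hT]
  ring

/-- Duality is applied to the code on `Rθ ^ (m - j)` with columns `x ↦ x * θ ^ i`, and to the code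
on the `j`-th power of the socle whose columns are all forms `x ↦ ∑ k, x k * a k`, each taken `η 0`
times. Nonzero values in the socle all have weight `w_{m-1}`, so the second code has constant weight
too. -/
theorem IsUniformizer.sum_multiplicity_mul_card (h : IsUniformizer θ m) {q : ℕ}
    (hq : q = Nat.card (R ⧸ (Ideal.span {θ} : Ideal R))) (hw : IsPositiveWeight w)
    (hs : HasMaximalSymmetry w) (hmono : IsWeaklyMonotone w θ m) (hd : RespectsDuality w)
    {P : ℕ → Prop} (hP : ∀ k, P k → 0 < k ∧ k < 2 * w (θ ^ 0)) (hP0 : P (w (θ ^ 0)))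
    {j : ℕ} (hj : 1 ≤ j) (hjm : j ≤ m) {η : ℕ → ℕ} (hη0 : 0 < η 0)
    (hη : ∀ s, m - j ≤ s → s < m →
      ∑ i ∈ Finset.range j, η i * w (θ ^ (s + i)) = η 0 * w (θ ^ (m - 1))) :
    ∑ i ∈ Finset.range j, η i * Nat.card {b // P (w b) ∧ θ ^ (m - j + i) * b ≠ 0} +
      η 0 * q ^ (m - j) = η 0 * q ^ m := by
  classical
  have hm := h.pos
  have hq2 := h.two_le_card_quotient hq
  have hlast : 0 < w (θ ^ (m - 1)) := hw.2 _ fun h0 => by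
    have := (h.pow_eq_zero_iff _).1 h0
    omega
  -- The number of forms that do not vanish at a given nonzero point of the socle power; repeating
  -- the columns of the cyclic code this many more times equalises the two constant weights.
  set K := (q - 1) * q ^ (m * j - 1) with hK
  have hKpos : 0 < K := Nat.mul_pos (by omega) (pow_pos (by omega) _)
  let I : Ideal R := Ideal.span {θ ^ (m - j)}
  let S : Ideal R := Ideal.span {θ ^ (m - 1)}
  let f : (Σ i : Fin j, Fin (K * η i)) → I →ₗ[R] R := fun p =>
    (LinearMap.toSpanSingleton R R (θ ^ (p.1 : ℕ))).comp I.subtype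
  choose L hL using exists_linear_form S (j := j)
  let g : (Fin j → R) × Fin (η 0) → (Fin j → S) →ₗ[R] R := fun p => L p.1
  have hne : Nonempty (Σ i : Fin j, Fin (K * η i)) :=
    ⟨⟨⟨0, hj⟩, ⟨0, Nat.mul_pos hKpos hη0⟩⟩⟩
  have hcard : Nat.card I = Nat.card (Fin j → S) := by
    rw [Nat.card_fun, h.card_span_pow hjm, h.card_span_pow (show 1 ≤ m by omega), pow_one,
      Nat.card_fin]
  have hf : ∀ x, x ≠ 0 → ∑ p, w (f p x) = K * (η 0 * w (θ ^ (m - 1))) := by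
    rintro ⟨x, hx⟩ hx0
    have hx0' : x ≠ 0 := fun h0 => hx0 (Subtype.ext h0)
    obtain ⟨u, s, hsm, rfl⟩ := h.exists_eq_unit_mul_pow hx0'
    rw [h.mem_span_pow_iff hsm] at hx
    rw [← hη s hx hsm, Finset.mul_sum]
    have hval : ∀ p, w (f p ⟨u * θ ^ s, (h.mem_span_pow_iff hsm).2 hx⟩) =
        w (θ ^ (s + (p.1 : ℕ))) := by
      intro p
      simp [f, mul_assoc, ← pow_add, hs.weight_unit_mul]
    simp only [hval]
    rw [card_sigma_fin_sum (fun i => K * η i) (fun i => w (θ ^ (s + i)))]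
    simp only [mul_assoc]
  have hLS : ∀ a x, L a x ∈ (Ideal.span {θ ^ (m - 1)} : Ideal R) := by
    intro a x
    rw [hL]
    exact Ideal.sum_mem _ fun k _ => h.mul_mem_span_pow (x k).2 (a k)
  have hLmem : ∀ a x, L a x ≠ 0 → w (L a x) = w (θ ^ (m - 1)) := by
    intro a x hax
    obtain ⟨u, s, hsm, hu⟩ := h.exists_eq_unit_mul_pow hax
    have h1 := hLS a x
    rw [hu, h.mem_span_pow_iff hsm] at h1
    obtain rfl : s = m - 1 := by omega
    rw [hu, hs.weight_unit_mul]
  have hg : ∀ x, x ≠ 0 → ∑ p, w (g p x) = K * (η 0 * w (θ ^ (m - 1))) := by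
    intro x hx
    have h1 : ∀ a, w (L a x) = if L a x ≠ 0 then w (θ ^ (m - 1)) else 0 := by
      intro a
      split_ifs with h0
      · exact hLmem a x h0
      · rw [not_not] at h0
        rw [h0, hw.1]
    have h2 := h.card_sum_mul_ne_zero hq hj x hx
    simp only [← hL] at h2
    rw [Fintype.sum_prod_type]
    simp only [g, h1, Finset.sum_const, Finset.card_univ, Fintype.card_fin, smul_eq_mul]
    rw [← Finset.mul_sum, ← Finset.sum_filter, Finset.sum_const, smul_eq_mul, hK, ← h2,
      Nat.card_eq_fintype_card, Fintype.card_subtype]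
    ring
  have key := hd.sum_card_eq hw.1 (fun b hb => h.weight_one_le hs hmono hb) hP hcard f g
    (Nat.mul_pos hKpos (Nat.mul_pos hη0 hlast)) hf hg
  have hfc : ∀ p, Nat.card {b // P (w b) ∧ ∃ x, f p x * b ≠ 0} =
      Nat.card {b // P (w b) ∧ θ ^ (m - j + (p.1 : ℕ)) * b ≠ 0} := by
    intro p
    refine Nat.card_congr (Equiv.subtypeEquivRight fun b => and_congr_right fun _ => ?_)
    constructor
    · rintro ⟨⟨x, hx⟩, hxb⟩ h0
      obtain ⟨c, rfl⟩ := Ideal.mem_span_singleton'.1 hx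
      apply hxb
      simp only [f, LinearMap.comp_apply, Submodule.subtype_apply,
        LinearMap.toSpanSingleton_apply, smul_eq_mul]
      rw [mul_assoc c, ← pow_add, mul_assoc, h0, mul_zero]
    · intro hb
      refine ⟨⟨θ ^ (m - j), Ideal.mem_span_singleton_self _⟩, ?_⟩
      simpa [f, ← pow_add] using hb
  -- The `b` not killed by `θ ^ (m - 1)` are the units; they have weight `w_0`, so `P` holds for
  -- them.
  have hunits : Nat.card {b // P (w b) ∧ θ ^ (m - 1) * b ≠ 0} + q ^ (m - 1) = q ^ m := by
    rw [← h.card_notMem_span_pow hq hm]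
    congr 1
    refine Nat.card_congr (Equiv.subtypeEquivRight fun b => ?_)
    rw [ne_eq, h.pow_mul_eq_zero_iff (by omega), show m - (m - 1) = 1 by omega]
    refine and_iff_right_of_imp fun hb => ?_
    rw [pow_one, h.mem_span_iff, not_not] at hb
    obtain ⟨u, rfl⟩ := hb
    have := hs.weight_unit_mul (θ := θ) u 0
    rw [pow_zero, mul_one] at this
    rw [this, ← pow_zero θ]
    exact hP0
  let G : (Fin j → R) → ℕ := fun a =>
    if ∃ k, IsUnit (a k) then Nat.card {b // P (w b) ∧ θ ^ (m - 1) * b ≠ 0} else 0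
  -- A form without unit coefficients vanishes on the socle power; one with a unit coefficient takes
  -- the value `θ ^ (m - 1)`.
  have hgc : ∀ p, Nat.card {b // P (w b) ∧ ∃ x, g p x * b ≠ 0} = G p.1 := by
    intro p
    simp only [G]
    split_ifs with hk
    · obtain ⟨k, u, hu⟩ := hk
      refine Nat.card_congr (Equiv.subtypeEquivRight fun b => and_congr_right fun _ => ?_)
      constructor
      · rintro ⟨x, hxb⟩ h0
        obtain ⟨c, hc⟩ := Ideal.mem_span_singleton'.1 (hLS p.1 x)
        apply hxb
        simp only [g, ← hc]
        rw [mul_assoc, h0, mul_zero]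
      · intro hb
        obtain ⟨v, hv⟩ := h.exists_pow_mul_unit_eq (m - 1) u
        let z : S := ⟨↑v⁻¹ * θ ^ (m - 1), Ideal.mem_span_singleton'.2 ⟨_, rfl⟩⟩
        refine ⟨Pi.single k z, ?_⟩
        have h1 : g p (Pi.single k z) = θ ^ (m - 1) := by
          simp only [g, hL]
          rw [Finset.sum_eq_single k]
          · rw [Pi.single_eq_same, ← hu]
            simp only [z]
            rw [mul_assoc, hv, Units.inv_mul_cancel_left]
          · intro i _ hi
            simp [hi]
          · simp
        rwa [h1]
    · rw [Nat.card_eq_zero]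
      left
      constructor
      rintro ⟨b, -, x, hxb⟩
      apply hxb
      simp only [g, hL]
      rw [Finset.sum_eq_zero, zero_mul]
      intro k _
      obtain ⟨c, hc⟩ := Ideal.mem_span_singleton'.1 (x k).2
      have hk' : ¬ IsUnit (p.1 k) := fun h1 => hk ⟨k, h1⟩
      have h0 := (h.pow_mul_eq_zero_iff (show m - 1 ≤ m by omega) (p.1 k)).2
        (by rw [show m - (m - 1) = 1 by omega, pow_one, h.mem_span_iff]; exact hk')
      rw [← hc, mul_assoc, h0, mul_zero]
  have hau := h.card_exists_isUnit hm hq j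
  simp only [hfc, hgc] at key
  rw [card_sigma_fin_sum (fun i => K * η i)
    (fun i => Nat.card {b // P (w b) ∧ θ ^ (m - j + i) * b ≠ 0}), Fintype.sum_prod_type] at key
  simp only [Finset.sum_const, Finset.card_univ, Fintype.card_fin, smul_eq_mul] at key
  simp only [G] at key
  rw [← Finset.mul_sum, ← Finset.sum_filter, Finset.sum_const, smul_eq_mul,
    ← Fintype.card_subtype, ← Nat.card_eq_fintype_card] at key
  simp only [mul_assoc K] at key
  rw [← Finset.mul_sum] at key
  exact add_mul_pow_eq_of_mul_eq hq2 hj hjm hunits hau key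

end NecessaryCondition

/-! ### Necessity: the resulting equations for the weights -/

section NecessaryCondition

variable {R : Type*} [Ring R] [Fintype R] [Nontrivial R] {θ : R} {m : ℕ} {w : R → ℕ}

/-- Both sides solve the same triangular system, with coefficients `η i` and nonzero leading
coefficient `η 0`: one by counting dual words, the other by summing the constant weight over the
cyclic code. Strong induction on `m - l` solves it. -/
theorem IsUniformizer.sum_weight_eq_card_mul (h : IsUniformizer θ m) {q : ℕ}
    (hq : q = Nat.card (R ⧸ (Ideal.span {θ} : Ideal R))) (hw : IsPositiveWeight w)
    (hs : HasMaximalSymmetry w) (hmono : IsWeaklyMonotone w θ m) (hd : RespectsDuality w)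
    {P : ℕ → Prop} (hP : ∀ k, P k → 0 < k ∧ k < 2 * w (θ ^ 0)) (hP0 : P (w (θ ^ 0)))
    {l : ℕ} (hl : l ≤ m) :
    ∑ x, w (x * θ ^ l) = Nat.card {b // P (w b) ∧ θ ^ l * b ≠ 0} * w (θ ^ (m - 1)) := by
  suffices H : ∀ j ≤ m, ∑ x, w (x * θ ^ (m - j)) =
      Nat.card {b // P (w b) ∧ θ ^ (m - j) * b ≠ 0} * w (θ ^ (m - 1)) by
    have := H (m - l) (by omega)
    rwa [show m - (m - l) = l by omega] at this
  intro j
  induction j using Nat.strong_induction_on with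
  | _ j ih =>
    intro hjm
    rcases Nat.eq_zero_or_pos j with rfl | hj
    · have h0 : θ ^ m = 0 := (h.pow_eq_zero_iff m).2 le_rfl
      simp [h0, hw.1]
    have hzero : ∀ s, m ≤ s → w (θ ^ s) = 0 := fun s hsm => by
      rw [(h.pow_eq_zero_iff s).2 hsm, hw.1]
    have hlast : 0 < w (θ ^ (m - 1)) := hw.2 _ fun h0 => by
      have := (h.pow_eq_zero_iff _).1 h0
      omega
    obtain ⟨η, hη0, hη⟩ := exists_multiplicity hzero hmono hlast hj hjm
    have h1 := h.sum_multiplicity_mul_card hq hw hs hmono hd hP hP0 hj hjm hη0 hη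
    have h2 := h.sum_multiplicity_mul_sum_weight hq hs hw.1 hjm hη
    obtain ⟨d, rfl⟩ : ∃ d, j = d + 1 := ⟨j - 1, by omega⟩
    rw [Finset.sum_range_succ'] at h1 h2
    have h3 : ∑ i ∈ Finset.range d, η (i + 1) * ∑ x, w (x * θ ^ (m - (d + 1) + (i + 1))) =
        (∑ i ∈ Finset.range d, η (i + 1) *
          Nat.card {b // P (w b) ∧ θ ^ (m - (d + 1) + (i + 1)) * b ≠ 0}) * w (θ ^ (m - 1)) := by
      rw [Finset.sum_mul]
      refine Finset.sum_congr rfl fun i hi => ?_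
      rw [Finset.mem_range] at hi
      have := ih (d - i) (by omega) (by omega)
      rw [show m - (d - i) = m - (d + 1) + (i + 1) by omega] at this
      rw [this, mul_assoc]
    rw [h3] at h2
    simp only [add_zero] at h1 h2
    apply Nat.eq_of_mul_eq_mul_left hη0
    generalize ∑ i ∈ Finset.range d, η (i + 1) *
      Nat.card {b // P (w b) ∧ θ ^ (m - (d + 1) + (i + 1)) * b ≠ 0} = T at h1 h2
    zify at *
    linear_combination h2 - (w (θ ^ (m - 1)) : ℤ) * h1

omit [Nontrivial R] in
-- In the sum over `x`, units contribute `(q ^ m - q ^ (m - 1)) * w_l`, and each nonunit is `y * θ`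
-- for exactly `q` values of `y`. The factor `q` clears denominators.
theorem IsUniformizer.card_quotient_mul_sum_weight (h : IsUniformizer θ m) (hm : 1 ≤ m) {q : ℕ}
    (hq : q = Nat.card (R ⧸ (Ideal.span {θ} : Ideal R))) (hs : HasMaximalSymmetry w) (l : ℕ) :
    q * ∑ x, w (x * θ ^ l) + q ^ m * w (θ ^ l) =
      q * (q ^ m * w (θ ^ l)) + ∑ x, w (x * θ ^ (l + 1)) := by
  classical
  have hfiber : ∀ z : R, Nat.card {y // y * θ = z} =
      if z ∈ (Ideal.span {θ} : Ideal R) then q else 0 := by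
    intro z
    split_ifs with hz
    · obtain ⟨y₀, rfl⟩ := Ideal.mem_span_singleton'.1 hz
      have h1 := h.card_span_pow hm
      rw [pow_one, ← hq] at h1
      rw [← h1]
      refine Nat.card_congr ((Equiv.subRight y₀).subtypeEquiv fun y => ?_)
      have h2 := h.mul_pow_eq_zero_iff hm (y - y₀)
      rw [pow_one, sub_mul, sub_eq_zero] at h2
      exact h2
    · rw [Nat.card_eq_zero]
      left
      exact ⟨fun y => hz (Ideal.mem_span_singleton'.2 ⟨y.1, y.2⟩)⟩
  have hnext : ∑ x, w (x * θ ^ (l + 1)) =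
      q * ∑ z with z ∈ (Ideal.span {θ} : Ideal R), w (z * θ ^ l) := by
    rw [← Finset.sum_fiberwise Finset.univ (fun y => y * θ), Finset.mul_sum, Finset.sum_filter]
    refine Finset.sum_congr rfl fun z _ => ?_
    rw [Finset.sum_congr rfl (g := fun _ => w (z * θ ^ l)), Finset.sum_const, smul_eq_mul,
      ← Fintype.card_subtype, ← Nat.card_eq_fintype_card, hfiber]
    · split_ifs <;> simp
    · intro y hy
      rw [Finset.mem_filter] at hy
      rw [← hy.2, pow_succ', mul_assoc]
  have hunit : ∑ z with z ∉ (Ideal.span {θ} : Ideal R), w (z * θ ^ l) + q ^ (m - 1) * w (θ ^ l) =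
      q ^ m * w (θ ^ l) := by
    rw [← h.card_notMem_span_pow hq hm, add_mul]
    congr 1
    rw [Finset.sum_congr rfl (g := fun _ => w (θ ^ l)), Finset.sum_const, smul_eq_mul,
      ← Fintype.card_subtype, ← Nat.card_eq_fintype_card, pow_one]
    intro z hz
    rw [Finset.mem_filter, h.mem_span_iff, not_not] at hz
    obtain ⟨u, rfl⟩ := hz.2
    exact hs.weight_unit_mul u l
  have hsplit := Finset.sum_filter_add_sum_filter_not Finset.univ
    (fun z => z ∈ (Ideal.span {θ} : Ideal R)) fun z => w (z * θ ^ l)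
  have hpow : q ^ m = q * q ^ (m - 1) := by rw [← pow_succ', Nat.sub_add_cancel hm]
  rw [hnext, ← hsplit, mul_add, ← hunit]
  rw [mul_add q (∑ z with z ∉ (Ideal.span {θ} : Ideal R), w (z * θ ^ l)), hunit, hpow]
  ring

theorem IsUniformizer.isMultipleOfHamming_or_of_respectsDuality (h : IsUniformizer θ m) {q : ℕ}
    (hq : q = Nat.card (R ⧸ (Ideal.span {θ} : Ideal R))) (hw : IsPositiveWeight w)
    (hs : HasMaximalSymmetry w) (hmono : IsWeaklyMonotone w θ m) (hd : RespectsDuality w) :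
    IsMultipleOfHamming w ∨ (m = 2 ∧ q = 2 ∧ w (θ ^ 1) = 2 * w (θ ^ 0)) := by
  classical
  have hm := h.pos
  have hq2 := h.two_le_card_quotient hq
  have hpos0 : 0 < w (θ ^ 0) := hw.2 _ (by simp)
  by_cases hex : ∃ i, i < m ∧ w (θ ^ i) ≠ w (θ ^ 0)
  swap
  · left
    push Not at hex
    refine ⟨w (θ ^ 0), hpos0, fun r => ?_⟩
    by_cases hr : r = 0
    · simp [hr, hw.1, hammingWeight]
    · obtain ⟨u, l, hl, rfl⟩ := h.exists_eq_unit_mul_pow hr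
      rw [hs.weight_unit_mul, hex l hl, hammingWeight, if_neg hr, mul_one]
  right
  obtain ⟨hKm, hKne⟩ := Nat.find_spec hex
  have hKmin : ∀ i < Nat.find hex, w (θ ^ i) = w (θ ^ 0) := fun i hi => by
    have := Nat.find_min hex hi
    push Not at this
    exact this (by omega)
  have hK1 : 1 ≤ Nat.find hex := by
    by_contra h0
    exact hKne (by rw [show Nat.find hex = 0 by omega])
  generalize Nat.find hex = K at hKm hKne hKmin hK1
  have hwK : ∀ s, s < m → (w (θ ^ s) = w (θ ^ 0) ↔ s < K) := by
    intro s hsm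
    refine ⟨fun heq => ?_, hKmin s⟩
    by_contra hle
    have h1 := hmono K s (by omega) hsm
    have h2 := hmono 0 K (Nat.zero_le _) hKm
    omega
  have hmem : ∀ b, w b = w (θ ^ 0) ↔ b ∉ (Ideal.span {θ ^ K} : Ideal R) := by
    intro b
    by_cases hb : b = 0
    · subst hb
      simp only [hw.1, Submodule.zero_mem, not_true_eq_false, iff_false]
      omega
    · obtain ⟨u, s, hsm, rfl⟩ := h.exists_eq_unit_mul_pow hb
      rw [hs.weight_unit_mul, h.mem_span_pow_iff hsm, hwK s hsm, not_le]
  -- With `P = {w_0}` the count runs over the complement of `Rθ ^ K`. For `l + K ≤ m` none of these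
  -- elements is killed by `θ ^ l`, so the count does not depend on `l`.
  have hψ : ∀ l, l + K ≤ m →
      ∑ x, w (x * θ ^ l) + q ^ (m - K) * w (θ ^ (m - 1)) = q ^ m * w (θ ^ (m - 1)) := by
    intro l hl
    rw [h.sum_weight_eq_card_mul hq hw hs hmono hd (P := fun k => k = w (θ ^ 0))
      (fun k hk => by omega) rfl (by omega), ← add_mul, ← h.card_notMem_span_pow hq hKm.le]
    congr 2
    refine Nat.card_congr (Equiv.subtypeEquivRight fun b => ?_)
    rw [hmem]
    refine and_iff_left_of_imp fun hb h0 => hb ?_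
    by_cases hb0 : b = 0
    · rw [hb0]; exact Submodule.zero_mem _
    · obtain ⟨u, s, hsm, rfl⟩ := h.exists_eq_unit_mul_pow hb0
      rw [h.pow_mul_unit_mul_pow_eq_zero_iff] at h0
      rw [h.mem_span_pow_iff hsm]
      omega
  -- Equal sums at `l` and `l + 1` turn the recursion into `∑ x, w (x * θ ^ l) = q ^ m * w_l`.
  have hstep : ∀ l, l + 1 + K ≤ m →
      q ^ K * w (θ ^ l) + w (θ ^ (m - 1)) = q ^ K * w (θ ^ (m - 1)) := by
    intro l hl
    have h1 := hψ l (by omega)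
    have h2 := hψ (l + 1) hl
    have h3 := h.card_quotient_mul_sum_weight hm hq hs l
    have h4 : ∑ x, w (x * θ ^ l) = ∑ x, w (x * θ ^ (l + 1)) := by omega
    rw [← h4] at h3
    obtain ⟨r, rfl⟩ : ∃ r, q = r + 1 := ⟨q - 1, by omega⟩
    have h5 : (r + 1) ^ m = (r + 1) ^ (m - K) * (r + 1) ^ K := by
      rw [← pow_add, Nat.sub_add_cancel hKm.le]
    have h6 : ∑ x, w (x * θ ^ l) = (r + 1) ^ m * w (θ ^ l) := by
      apply Nat.eq_of_mul_eq_mul_left (show 0 < r by omega)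
      linarith
    rw [h6, h5, mul_assoc, mul_assoc, ← mul_add] at h1
    exact Nat.eq_of_mul_eq_mul_left (pow_pos (by omega) _) h1
  have h0 := hstep 0 (by omega)
  have hqK : q ≤ q ^ K := Nat.le_self_pow (by omega) q
  by_cases hlt : w (θ ^ (m - 1)) < 2 * w (θ ^ 0)
  · exfalso
    have h1 := h.sum_weight_eq_card_mul hq hw hs hmono hd
      (P := fun k => 0 < k ∧ k < 2 * w (θ ^ 0)) (fun k hk => hk) ⟨hpos0, by omega⟩
      (Nat.zero_le m)
    have h2 := hψ 0 (by omega)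
    have h3 : Nat.card {b // (0 < w b ∧ w b < 2 * w (θ ^ 0)) ∧ θ ^ 0 * b ≠ 0} + q ^ (m - m) =
        q ^ m := by
      rw [← h.card_notMem_span_pow hq le_rfl]
      congr 1
      refine Nat.card_congr (Equiv.subtypeEquivRight fun b => ?_)
      have h4 : θ ^ m = 0 := (h.pow_eq_zero_iff m).2 le_rfl
      simp only [h4, pow_zero, one_mul, Ideal.span_singleton_zero, Ideal.mem_bot]
      refine and_iff_right_of_imp fun hb => ⟨hw.2 b hb, ?_⟩
      have := h.weight_le_last hs hmono hb
      rw [pow_zero] at hlt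
      omega
    rw [h1, ← add_mul] at h2
    have hlast : 0 < w (θ ^ (m - 1)) := by
      have := hmono 0 (m - 1) (Nat.zero_le _) (by omega)
      omega
    have h4 := Nat.eq_of_mul_eq_mul_right hlast h2
    have h5 : q ^ (m - K) = q ^ (m - m) := by omega
    have := Nat.pow_right_injective hq2 h5
    omega
  -- Inserting `w_{m-1} ≥ 2 * w_0` into `q ^ K * w_0 = (q ^ K - 1) * w_{m-1}` gives `q ^ K ≥ 2 * (q
  -- ^ K - 1)`.
  · have hQ : q ^ K ≤ 2 := by
      by_contra hQ
      have h1 : q ^ K * (2 * w (θ ^ 0)) ≤ q ^ K * w (θ ^ (m - 1)) :=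
        Nat.mul_le_mul_left _ (by omega)
      nlinarith
    obtain rfl : q = 2 := by omega
    have hK : K = 1 := by
      have : 2 ^ K ≤ 2 ^ 1 := by simpa using hQ
      have := (Nat.pow_le_pow_iff_right (by norm_num)).1 this
      omega
    subst hK
    have hm2 : m = 2 := by
      by_contra hne
      -- For `m ≥ 3` the relation also holds at `l = 1`; compared with `l = 0` it forces `w_1 =
      -- w_0`, against `K = 1`.
      have h1 := hstep 1 (by omega)
      apply hKne
      omega
    subst hm2
    refine ⟨rfl, rfl, ?_⟩
    rw [show 2 - 1 = 1 from rfl] at h0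
    omega

end NecessaryCondition

end RingWeight

theorem mainTheorem3 {R : Type*} [Ring R] [Finite R] [Nontrivial R]
    (hR : RingWeight.IsChainRing R)
    -- a generator of the maximal left ideal, its nilpotency index, and the residue field order
    (θ : R) (hθ : (Ideal.span {θ} : Ideal R).IsMaximal)
    (m : ℕ) (hm : IsLeast {k : ℕ | 1 ≤ k ∧ θ ^ k = 0} m)
    (q : ℕ) (hq : q = Nat.card (R ⧸ (Ideal.span {θ} : Ideal R)))
    (w : R → ℕ) (hw : RingWeight.IsPositiveWeight w)
    (hsymm : RingWeight.HasMaximalSymmetry w)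
    (hmono : RingWeight.IsWeaklyMonotone w θ m) :
    RingWeight.RespectsDuality w ↔
      RingWeight.IsMultipleOfHamming w ∨
        (m = 2 ∧ q = 2 ∧ w (θ ^ 1) = 2 * w (θ ^ 0)) := by
  have h := RingWeight.isUniformizer_of_isChainRing hR hθ hm
  have := Fintype.ofFinite R
  refine ⟨fun hd => h.isMultipleOfHamming_or_of_respectsDuality hq hw hsymm hmono hd, ?_⟩
  rintro (hH | ⟨rfl, rfl, h1⟩)
  · exact h.respectsDuality_of_isMultipleOfHamming hH
  · exact h.respectsDuality_of_lee hq.symm hw hsymm h1
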